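/- **Setting.** Let $F(\mathbf x)=\mathbb E_\xi[f(\mathbf x;\xi)]$ on $\mathbb R^d$, where $f(\cdot;\xi)$ is differentiable, and let $F$ be differentiable and bounded from below with $L$-Lipschitz gradient, $L>0$. Write $F^\star=\inf F$. N-MSGE, started at a deterministic $\mathbf x^1$, with an arbitrary reference point $\mathbf y\in\mathbb R^d$ and samples $\xi^t_1,\dots,\xi^t_{B_t+2}$ distributed as $\xi$ in iteration $t=1,2,\dots$, is $$\mathbf x^{t+1}=\mathbf x^t-\alpha_t\boldsymbol\Psi\Big(\nabla f(\mathbf x^t;\xi^t_1)-\nabla f(\mathbf y;\xi^t_2)+\frac1{B_t}\sum_{j=1}^{B_t}\nabla f(\mathbf y;\xi^t_{j+2})\Big),\qquad \alpha_t=\frac{a}{(t+1)^{1/2}},\qquad B_t=\Big\lceil t^{\frac{p}{2(p-1)}}\Big\rceil .$$ **Noise.** Let $\mathbf z^t_1=\nabla f(\mathbf x^t;\xi^t_1)-\nabla F(\mathbf x^t)$ and $\mathbf z^t_j=\nabla f(\mathbf y;\xi^t_j)-\nabla F(\mathbf y)$ for $2\le j\le B_t+2$. In each iteration $t$ the vectors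 $\mathbf z^t_1,\dots,\mathbf z^t_{B_t+2}$ are IID with a density $P$ on $\mathbb R^d$, and jointly independent of $\mathbf x^1,\dots,\mathbf x^t$. For some $E_0>0$ and all $\|\mathbf x\|\le E_0$ the set $\{\mathbf u: P(\mathbf u)>0,\ P(\mathbf u-\mathbf x)>0\}$ has positive Lebesgue measure. A random vector $\mathbf z$ with density $P$ satisfies $\mathbb E[\mathbf z]=\mathbf 0$ and $\mathbb E\|\mathbf z\|^p\le\sigma^p$, for some $p\in(1,2]$ and $\sigma>0$. **Nonlinearity.** $\boldsymbol\Psi:\mathbb R^d\to\mathbb R^d$ is of one of two kinds. - Component-wise: $\boldsymbol\Psi(\mathbf x)=[\psi(x_1),\dots,\psi(x_d)]^\top$, where $\psi:\mathbb R\to\mathbb R$ is twice continuously differentiable, non-decreasing, odd, strictly increasing on some interval $(-c,c)$ with $c>0$, and $\psi,\psi',\psi''$ are bounded. - Joint: $\boldsymbol\Psi(\mathbf x)=\mathbf x\,\varphi(\|\mathbf x\|)$, where $\varphi:\mathbb R\to\mathbb R$ is continuously differentiable, $\varphi$ is positive and non-increasing and $b\mapsto b\varphi(b)$ is non-decreasing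 on $(0,\infty)$, and $\mathbf x\varphi(\|\mathbf x\|)$ and the matrices $\varphi'(\|\mathbf x\|)\frac{\mathbf x\mathbf x^\top}{\|\mathbf x\|}+\varphi(\|\mathbf x\|)I$ (in operator norm) are uniformly bounded in $\mathbf x\in\mathbb R^d$. Let $C>0$ be such that $\|\boldsymbol\Psi(\mathbf x)\|\le C$ for all $\mathbf x$. Let $\boldsymbol\Phi(\mathbf u)=\mathbb E[\boldsymbol\Psi(\mathbf u+\mathbf z_1-\mathbf z_2)]$, with $\mathbf z_1,\mathbf z_2$ independent of density $P$. **Claim.** There are constants $\gamma_1,\gamma_2>0$, depending only on $\boldsymbol\Psi$ and $P$, such that $$\langle\boldsymbol\Phi(\mathbf u),\mathbf u\rangle\ge\min\{\gamma_1\|\mathbf u\|,\gamma_2\|\mathbf u\|^2\}\quad\text{for all }\mathbf u\in\mathbb R^d.$$ For any such $\gamma_1,\gamma_2$, and any $a$ with $$0<a\le\min\Big\{1,\ \frac{\gamma_2}{1+8C^2},\ \frac{\frac12\gamma_1}{(1+8C^2)\big(LC+\frac12\|\nabla F(\mathbf x^1)\|\big)}\Big\},$$ there is a constant $A>0$ such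 that for all integers $t\ge2$ and all $\delta\in(0,1)$, with probability at least $1-\delta$, $$\min_{1\le k\le t}\|\nabla F(\mathbf x^k)\|^2\le A\,\frac{\log(t/\delta)}{\sqrt t}.$$ Here $A$ depends only on the nonlinearity $\boldsymbol\Psi$, the noise ($P,p,\sigma$), and $C,\gamma_1,\gamma_2,L,a,F(\mathbf x^1)-F^\star,\|\nabla F(\mathbf x^1)\|$; it does not depend on $t$, $\delta$, or otherwise on $F$, $f$, the initial and reference points or the samples. -/

import Mathlib

open MeasureTheory ProbabilityTheory

noncomputable section

/-- The Euclidean space `ℝ^d`. -/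
abbrev Vec (d : ℕ) : Type := EuclideanSpace ℝ (Fin d)

/-! ## Problem and nonlinearity -/

/-- The population cost `F(x) = E_ξ[f(x; ξ)]`, where `D` is the distribution of `ξ`. -/
def populationCost {d : ℕ} {Ξ : Type*} [MeasurableSpace Ξ] (f : Vec d → Ξ → ℝ)
    (D : Measure Ξ) (x : Vec d) : ℝ :=
  ∫ s, f x s ∂D

/-- The stochastic gradient `∇f(x; s)` returned by the first-order oracle. -/
def stochGrad {d : ℕ} {Ξ : Type*} (f : Vec d → Ξ → ℝ) (x : Vec d) (s : Ξ) : Vec d :=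
  gradient (fun x' => f x' s) x

/-- `F` is bounded from below and has an `L`-Lipschitz continuous gradient. -/
structure IsSmoothObjective {d : ℕ} (F : Vec d → ℝ) (L : ℝ) : Prop where
  bddBelow : BddBelow (Set.range F)
  differentiable : Differentiable ℝ F
  lipschitz : ∀ x y, ‖gradient F x - gradient F y‖ ≤ L * ‖x - y‖

/-- Conditions on the scalar map `ψ` of a component-wise nonlinearity. -/
structure IsComponentMap (ψ : ℝ → ℝ) : Prop where
  contDiff : ContDiff ℝ 2 ψ
  monotone : Monotone ψ
  odd : ∀ x, ψ (-x) = -ψ x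
  strictMonoOn : ∃ c > 0, StrictMonoOn ψ (Set.Ioo (-c) c)
  bounded : ∃ C₁ > 0, ∀ x, |ψ x| ≤ C₁
  deriv_bounded : ∃ K₁ > 0, ∀ x, |deriv ψ x| ≤ K₁
  deriv2_bounded : ∃ K₂ > 0, ∀ x, |deriv (deriv ψ) x| ≤ K₂

/-- The matrix `φ'(‖x‖) x xᵀ / ‖x‖ + φ(‖x‖) I`, as a linear operator
(at `x = 0` the first summand is `0`). -/
def jointJacobian {d : ℕ} (φ : ℝ → ℝ) (x : Vec d) : Vec d →L[ℝ] Vec d :=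
  (deriv φ ‖x‖ / ‖x‖) • (innerSL ℝ x).smulRight x + φ ‖x‖ • ContinuousLinearMap.id ℝ (Vec d)

/-- Conditions on the scalar map `φ` of a joint nonlinearity `x ↦ x φ(‖x‖)` on `ℝ^d`. -/
structure IsJointMap (d : ℕ) (φ : ℝ → ℝ) : Prop where
  contDiff : ContDiff ℝ 1 φ
  mul_monotoneOn : MonotoneOn (fun a => a * φ a) (Set.Ioi 0)
  antitoneOn : AntitoneOn φ (Set.Ioi 0)
  pos : ∀ a > 0, 0 < φ a
  bounded : ∃ C₂ > 0, ∀ x : Vec d, ‖φ ‖x‖ • x‖ ≤ C₂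
  jacobian_bounded : ∃ K₃ > 0, ∀ x : Vec d, ‖jointJacobian φ x‖ ≤ K₃

/-- Smooth bounded nonlinearities, component-wise or joint. -/
def IsSmoothNonlinearity {d : ℕ} (Ψ : Vec d → Vec d) : Prop :=
  (∃ ψ, IsComponentMap ψ ∧ ∀ x i, Ψ x i = ψ (x i)) ∨
  (∃ φ, IsJointMap d φ ∧ ∀ x, Ψ x = φ ‖x‖ • x)

/-! ## Noise -/

/-- The probability distribution on `ℝ^d` with density `P`. -/
def densityLaw {d : ℕ} (P : Vec d → ℝ) : Measure (Vec d) :=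
  volume.withDensity fun z => ENNReal.ofReal (P z)

/-- `P` is a probability density of a centred noise with `p`-th moment at most `σ^p`, such that
the sets `S_x = {y | P(y) > 0 and P(y - x) > 0}` have positive Lebesgue measure for all small `x`. -/
structure IsNoiseDensity {d : ℕ} (P : Vec d → ℝ) (p σ : ℝ) : Prop where
  measurable : Measurable P
  nonneg : ∀ z, 0 ≤ P z
  isProbability : densityLaw P Set.univ = 1
  overlap : ∃ E₀ > 0, ∀ x : Vec d, ‖x‖ ≤ E₀ →
    0 < volume {y : Vec d | 0 < P y ∧ 0 < P (y - x)}
  one_lt : 1 < p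
  le_two : p ≤ 2
  sigma_pos : 0 < σ
  unbiased : ∫ z, z ∂(densityLaw P) = 0
  moment : ∫⁻ z, ‖z‖ₑ ^ p ∂(densityLaw P) ≤ ENNReal.ofReal (σ ^ p)

/-- The denoised nonlinearity `Φ(y) = E[Ψ(y + z₁ - z₂)]`, with `z₁, z₂` independent of density
`P`. -/
def denoised {d : ℕ} (Ψ : Vec d → Vec d) (P : Vec d → ℝ) (y : Vec d) : Vec d :=
  ∫ w, Ψ (y + (w.1 - w.2)) ∂((densityLaw P).prod (densityLaw P))

/-- `γ₁, γ₂ > 0` and `⟨Φ(y), y⟩ ≥ min {γ₁ ‖y‖, γ₂ ‖y‖²}` for all `y`. -/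
structure AreDenoisingConstants {d : ℕ} (Ψ : Vec d → Vec d) (P : Vec d → ℝ) (γ₁ γ₂ : ℝ) :
    Prop where
  pos₁ : 0 < γ₁
  pos₂ : 0 < γ₂
  lower_bound : ∀ y, min (γ₁ * ‖y‖) (γ₂ * ‖y‖ ^ 2) ≤ inner ℝ (denoised Ψ P y) y

/-! ## The method N-MSGE -/

/-- The step size `α_t = a / (t + 1)^η`. -/
def stepSize (a η : ℝ) (t : ℕ) : ℝ := a / ((t : ℝ) + 1) ^ η

/-- The admissible range of the step-size parameter; `C` bounds the nonlinearity and `G` is the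
norm of the gradient at the initial point. -/
def StepSizeCondition (a η γ₁ γ₂ C L G : ℝ) : Prop :=
  0 < a ∧
  a ≤ min 1 (min (γ₂ / (1 + 8 * C ^ 2))
    ((1 - η) * γ₁ / ((1 + 8 * C ^ 2) * (L * C + (1 - η) * G))))

/-- The batch size `B_t = t^{p / (2(p-1))}`, rounded up to an integer. -/
def batchSize (p : ℝ) (t : ℕ) : ℕ := ⌈(t : ℝ) ^ (p / (2 * (p - 1)))⌉₊

/-- The mini-batch symmetrized gradient estimator at the model `x` with reference point `y`,
batch size `b` and samples `s 1, …, s (b + 2)`. -/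
def msge {d : ℕ} {Ξ : Type*} (f : Vec d → Ξ → ℝ) (b : ℕ) (y x : Vec d) (s : ℕ → Ξ) : Vec d :=
  stochGrad f x (s 1) - stochGrad f y (s 2)
    + (1 / (b : ℝ)) • ∑ j ∈ Finset.Icc 1 b, stochGrad f y (s (j + 2))

/-- `x 1, x 2, …` are the models generated by N-MSGE from the initial model `x₁`, the reference
point `y` and the samples `ξ t j`, `1 ≤ j ≤ B t + 2`, drawn in the iterations `t ≥ 1`. -/
structure IsNMSGE {d : ℕ} {Ω Ξ : Type*} (f : Vec d → Ξ → ℝ) (Ψ : Vec d → Vec d) (α : ℕ → ℝ)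
    (B : ℕ → ℕ) (x₁ y : Vec d) (ξ : ℕ → ℕ → Ω → Ξ) (x : ℕ → Ω → Vec d) : Prop where
  init : ∀ ω, x 1 ω = x₁
  step : ∀ t ≥ 1, ∀ ω,
    x (t + 1) ω = x t ω - α t • Ψ (msge f (B t) y (x t ω) fun j => ξ t j ω)

/-- The noise vectors of iteration `t`: `z^t_1 = ∇f(x^t; ξ^t_1) - ∇F(x^t)` and
`z^t_j = ∇f(y; ξ^t_j) - ∇F(y)` for `j ≥ 2`. -/
def gradNoise {d : ℕ} {Ω Ξ : Type*} (f : Vec d → Ξ → ℝ) (F : Vec d → ℝ) (y : Vec d)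
    (ξ : ℕ → ℕ → Ω → Ξ) (x : ℕ → Ω → Vec d) (t j : ℕ) (ω : Ω) : Vec d :=
  if j = 1 then stochGrad f (x t ω) (ξ t j ω) - gradient F (x t ω)
  else stochGrad f y (ξ t j ω) - gradient F y

/-- In each iteration `t` the noise vectors `z t 1, …, z t (B t + 2)` are independent, identically
distributed with density `P`, and jointly independent of the models `x 1, …, x t`. -/
structure IsIIDNoise {d : ℕ} {Ω : Type*} [MeasurableSpace Ω] (μ : Measure Ω) (P : Vec d → ℝ)
    (B : ℕ → ℕ) (z : ℕ → ℕ → Ω → Vec d) (x : ℕ → Ω → Vec d) : Prop where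
  measurable : ∀ t ≥ 1, ∀ j ∈ Finset.Icc 1 (B t + 2), Measurable (z t j)
  law : ∀ t ≥ 1, ∀ j ∈ Finset.Icc 1 (B t + 2), μ.map (z t j) = densityLaw P
  indep : ∀ t ≥ 1, iIndepFun (fun j : Finset.Icc 1 (B t + 2) => z t j) μ
  indep_past : ∀ t ≥ 1, IndepFun (fun ω (j : Finset.Icc 1 (B t + 2)) => z t j ω)
    (fun ω (k : Finset.Icc 1 t) => x k ω) μ

end

/-! Denoising. The law of `z₁ - z₂` is symmetric and `Ψ` is odd, so `2⟨Φ(u), u⟩` is the mean of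
`⟨Ψ(w + u) - Ψ(w - u), u⟩` over `w = z₁ - z₂`. Monotonicity of `Ψ` makes the integrand nonnegative.
On a small ball near the origin, which the overlap condition on `P` charges, `Ψ` is strongly
monotone; there the integrand is quadratic in small `u` and, by monotonicity along rays, at least
linear in large `u`. See `exists_areDenoisingConstants`.

Bias. The estimator equals `∇F(x) + (z₁ - z₂)` plus a batch mean of centred noise; the reference
gradient cancels (`msge_eq`). Truncation bounds the first moment of the batch mean by `3σ/√t`
(`integral_norm_sum_le`, `batchSize_rpow_le`), and since `Ψ` is Lipschitz, the mean step differs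
from `Φ(∇F(x))` by `O(1/√t)`.

Concentration. The descent inequality gives a decrease of `α_t⟨∇F, Ψ⟩` up to `O(1/t)`. As `Ψ` is
bounded, gradients grow at most like `√t`, so `α_t‖∇F(x^t)‖ ≤ M` for all `t`. This lets the bias be
absorbed into half of the progress `α_t min{γ₁‖∇F‖, γ₂‖∇F‖²}` up to `O(1/t)`, and, for a small fixed
`lam`, the Hoeffding term into another quarter. Hence `exp(lam * potential)` has non-increasing mean
(`lintegral_exp_potential_succ_le`), and Markov's inequality bounds the potential with high
probability.

Rate. The errors `c/k` sum to `O(log t)` while the step sizes sum to at least a multiple of `√t`, so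
the least progress among the iterates is `O(log(t/δ)/√t)`. The initial gradient bound turns this
into a bound on the squared norm. -/

noncomputable section

/-! ### Regularity of component-wise nonlinearities -/

/-- Lipschitz, odd, monotone operators which are strongly monotone on some small ball. -/
structure IsRegularOperator {d : ℕ} (Ψ : Vec d → Vec d) : Prop where
  lipschitz : ∃ K : NNReal, LipschitzWith K Ψ
  monotone : ∀ a b, 0 ≤ inner ℝ (Ψ a - Ψ b) (a - b)
  odd : ∀ a, Ψ (-a) = -Ψ a
  local_strong : ∀ ε > 0, ∃ w₀ : Vec d, ∃ r > 0, ∃ κ > 0, ‖w₀‖ < ε ∧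
    ∀ a ∈ Metric.ball w₀ r, ∀ b ∈ Metric.ball w₀ r,
      κ * ‖a - b‖ ^ 2 ≤ inner ℝ (Ψ a - Ψ b) (a - b)

lemma inner_eq_sum_mul {d : ℕ} (x y : Vec d) : inner ℝ x y = ∑ i, x i * y i := by
  simp [PiLp.inner_apply, mul_comm]

/-- The derivative may vanish at `0` itself even though `ψ` is strictly increasing there; the mean
value theorem supplies a nearby point where it does not. This is why strong monotonicity is only
asked around some `w₀` close to the origin. -/
lemma IsComponentMap.exists_deriv_pos {ψ : ℝ → ℝ} (h : IsComponentMap ψ) {ε : ℝ} (hε : 0 < ε) :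
    ∃ s, 0 < s ∧ s < ε ∧ 0 < deriv ψ s := by
  obtain ⟨c, hc, hmono⟩ := h.strictMonoOn
  have hd : Differentiable ℝ ψ := h.contDiff.differentiable (by norm_num)
  have hm : 0 < min c ε := lt_min hc hε
  obtain ⟨s, hs, hs'⟩ := exists_deriv_eq_slope ψ (a := 0) (b := min c ε / 2) (by linarith)
    hd.continuous.continuousOn hd.differentiableOn
  have h1 : min c ε ≤ c := min_le_left _ _
  have h2 : min c ε ≤ ε := min_le_right _ _
  refine ⟨s, hs.1, by linarith [hs.2], ?_⟩
  rw [hs']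
  have : ψ 0 < ψ (min c ε / 2) := hmono ⟨by linarith, hc⟩ ⟨by linarith, by linarith⟩ (by linarith)
  exact div_pos (by linarith) (by linarith)

/-- A `C¹` function with positive derivative at a point is strongly monotone nearby. -/
lemma exists_strongly_monotone_of_deriv_pos {ψ : ℝ → ℝ} (h : ContDiff ℝ 1 ψ) {s : ℝ}
    (hs : 0 < deriv ψ s) :
    ∃ r > 0, ∃ κ > 0, ∀ a ∈ Metric.ball s r, ∀ b ∈ Metric.ball s r,
      κ * (a - b) ^ 2 ≤ (ψ a - ψ b) * (a - b) := by
  have hcont : Continuous (deriv ψ) := h.continuous_deriv le_rfl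
  have hd : Differentiable ℝ ψ := h.differentiable (by norm_num)
  have hev : ∀ᶠ x in nhds s, deriv ψ s / 2 < deriv ψ x :=
    hcont.continuousAt.eventually_const_lt (by linarith)
  obtain ⟨r, hr, hball⟩ := Metric.eventually_nhds_iff_ball.mp hev
  refine ⟨r, hr, deriv ψ s / 2, by linarith, ?_⟩
  have key : ∀ a ∈ Metric.ball s r, ∀ b ∈ Metric.ball s r, b ≤ a →
      deriv ψ s / 2 * (a - b) ≤ ψ a - ψ b := by
    intro a ha b hb hab
    exact (convex_ball s r).mul_sub_le_image_sub_of_le_deriv hd.continuous.continuousOn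
      hd.differentiableOn
      (fun x hx => (hball x (interior_subset hx)).le) b hb a ha hab
  intro a ha b hb
  rcases le_total b a with hab | hab
  · nlinarith [key a ha b hb hab]
  · nlinarith [key b hb a ha hab]

lemma IsComponentMap.isRegularOperator {d : ℕ} {ψ : ℝ → ℝ} (h : IsComponentMap ψ)
    {Ψ : Vec d → Vec d} (hΨ : ∀ x i, Ψ x i = ψ (x i)) : IsRegularOperator Ψ := by
  have hd : Differentiable ℝ ψ := h.contDiff.differentiable (by norm_num)
  refine ⟨?_, ?_, ?_, ?_⟩
  · obtain ⟨K, hK, hder⟩ := h.deriv_bounded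
    refine ⟨K.toNNReal, LipschitzWith.of_dist_le_mul fun a b => ?_⟩
    have hlip : LipschitzWith K.toNNReal ψ :=
      lipschitzWith_of_nnnorm_deriv_le hd fun x => by
        rw [← NNReal.coe_le_coe, Real.coe_toNNReal K hK.le]
        exact hder x
    rw [dist_eq_norm, dist_eq_norm, EuclideanSpace.norm_eq, EuclideanSpace.norm_eq]
    refine Real.sqrt_le_iff.mpr ⟨by positivity, ?_⟩
    rw [mul_pow, Real.sq_sqrt (by positivity), Finset.mul_sum]
    refine Finset.sum_le_sum fun i _ => ?_
    rw [← mul_pow]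
    gcongr
    have := hlip.dist_le_mul (a i) (b i)
    simpa [Real.dist_eq, hΨ] using this
  · intro a b
    rw [inner_eq_sum_mul]
    refine Finset.sum_nonneg fun i _ => ?_
    simp only [PiLp.sub_apply, hΨ]
    rcases le_total (b i) (a i) with hab | hab
    · exact mul_nonneg (sub_nonneg.mpr (h.monotone hab)) (sub_nonneg.mpr hab)
    · exact mul_nonneg_of_nonpos_of_nonpos (sub_nonpos.mpr (h.monotone hab))
        (sub_nonpos.mpr hab)
  · intro a
    ext i
    simp [hΨ, h.odd]
  · intro ε hε
    -- The centre will have all coordinates equal to `s`, hence norm `√d * s`; dividing by `d + 1`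
    -- keeps this below `ε` and also covers `d = 0`.
    obtain ⟨s, hs0, hsε, hs⟩ := h.exists_deriv_pos (ε := ε / (d + 1)) (by positivity)
    obtain ⟨r, hr, κ, hκ, hstrong⟩ :=
      exists_strongly_monotone_of_deriv_pos (h.contDiff.of_le (by norm_num)) hs
    refine ⟨WithLp.toLp 2 fun _ => s, r, hr, κ, hκ, ?_, ?_⟩
    · rw [EuclideanSpace.norm_eq]
      have h1 : (∑ i : Fin d, ‖(WithLp.toLp 2 fun _ => s : Vec d) i‖ ^ 2) = d * s ^ 2 := by
        simp
      rw [h1, Real.sqrt_lt' hε]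
      have h2 : s * (d + 1) < ε := (lt_div_iff₀ (by positivity)).mp hsε
      have h3 : (s * (d + 1)) ^ 2 < ε ^ 2 := by gcongr
      nlinarith [sq_nonneg s, sq_nonneg ((d : ℝ) * s), (Nat.cast_nonneg d : (0 : ℝ) ≤ d),
        mul_nonneg (Nat.cast_nonneg d : (0 : ℝ) ≤ d) (sq_nonneg s)]
    · intro a ha b hb
      have hcoord : ∀ v : Vec d, v ∈ Metric.ball (WithLp.toLp 2 fun _ => s : Vec d) r →
          ∀ i, v i ∈ Metric.ball s r := by
        intro v hv i
        rw [Metric.mem_ball, dist_eq_norm] at hv ⊢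
        refine lt_of_le_of_lt ?_ hv
        exact PiLp.norm_apply_le (v - WithLp.toLp 2 fun _ => s) i
      rw [inner_eq_sum_mul, EuclideanSpace.norm_sq_eq, Finset.mul_sum]
      refine Finset.sum_le_sum fun i _ => ?_
      simpa [hΨ] using hstrong (a i) (hcoord a ha i) (b i) (hcoord b hb i)

/-! ### Regularity of joint nonlinearities -/

section Joint
variable {d : ℕ} {φ : ℝ → ℝ} {Ψ : Vec d → Vec d}

lemma IsJointMap.le_zero (h : IsJointMap d φ) {s : ℝ} (hs : 0 < s) : φ s ≤ φ 0 := by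
  have hc : Filter.Tendsto φ (nhdsWithin 0 (Set.Ioi 0)) (nhds (φ 0)) :=
    h.contDiff.continuous.continuousAt.mono_left nhdsWithin_le_nhds
  refine ge_of_tendsto hc ?_
  filter_upwards [Ioo_mem_nhdsGT hs] with x hx
  exact h.antitoneOn hx.1 hs hx.2.le

lemma IsJointMap.zero_pos (h : IsJointMap d φ) : 0 < φ 0 :=
  (h.pos 1 one_pos).trans_le (h.le_zero one_pos)

lemma IsJointMap.antitoneOn_Ici (h : IsJointMap d φ) : AntitoneOn φ (Set.Ici 0) := by
  intro s hs t ht hst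
  rcases (Set.mem_Ici.mp hs).eq_or_lt with rfl | hs'
  · rcases (Set.mem_Ici.mp ht).eq_or_lt with rfl | ht'
    · rfl
    · exact h.le_zero ht'
  · exact h.antitoneOn hs' (hs'.trans_le hst) hst

lemma IsJointMap.nonneg (h : IsJointMap d φ) {s : ℝ} (hs : 0 ≤ s) : 0 ≤ φ s := by
  rcases hs.eq_or_lt with rfl | hs'
  · exact h.zero_pos.le
  · exact (h.pos s hs').le

lemma IsJointMap.mul_monotoneOn_Ici (h : IsJointMap d φ) :
    MonotoneOn (fun s => s * φ s) (Set.Ici 0) := by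
  intro s hs t ht hst
  rcases (Set.mem_Ici.mp hs).eq_or_lt with rfl | hs'
  · simpa using mul_nonneg (Set.mem_Ici.mp ht) (h.nonneg ht)
  · exact h.mul_monotoneOn hs' (hs'.trans_le hst) hst

/-- Polarised form of the pairing defining monotonicity of `x ↦ φ(‖x‖) x`. -/
lemma inner_smul_sub_smul (s t : ℝ) (a b : Vec d) :
    inner ℝ (s • a - t • b) (a - b)
      = (s + t) / 2 * ‖a - b‖ ^ 2 + (s - t) / 2 * (‖a‖ ^ 2 - ‖b‖ ^ 2) := by
  rw [norm_sub_sq_real]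
  simp only [inner_sub_left, inner_sub_right, real_inner_smul_left, real_inner_self_eq_norm_sq,
    real_inner_comm a b]
  ring

/-- Cauchy–Schwarz bounds the pairing below by `(‖a‖φ(‖a‖) - ‖b‖φ(‖b‖))(‖a‖ - ‖b‖)`, a product of
factors of equal sign. -/
lemma IsJointMap.monotone_operator (h : IsJointMap d φ) (a b : Vec d) :
    0 ≤ inner ℝ (φ ‖a‖ • a - φ ‖b‖ • b) (a - b) := by
  have hab : inner ℝ a b ≤ ‖a‖ * ‖b‖ := real_inner_le_norm a b
  have ha := h.nonneg (norm_nonneg a)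
  have hb := h.nonneg (norm_nonneg b)
  have hmono : 0 ≤ (‖a‖ * φ ‖a‖ - ‖b‖ * φ ‖b‖) * (‖a‖ - ‖b‖) := by
    rcases le_total ‖b‖ ‖a‖ with hle | hle
    · exact mul_nonneg (sub_nonneg.mpr (h.mul_monotoneOn_Ici (norm_nonneg b) (norm_nonneg a) hle))
        (sub_nonneg.mpr hle)
    · exact mul_nonneg_of_nonpos_of_nonpos
        (sub_nonpos.mpr (h.mul_monotoneOn_Ici (norm_nonneg a) (norm_nonneg b) hle))
        (sub_nonpos.mpr hle)
  rw [inner_smul_sub_smul, norm_sub_sq_real]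
  nlinarith [mul_le_mul_of_nonneg_left hab (add_nonneg ha hb)]

/-- In the splitting `φ(‖a‖)(a - b) + (φ(‖a‖) - φ(‖b‖))b`, monotonicity of `s ↦ sφ(s)` bounds the
second term by `φ(‖a‖)(‖a‖ - ‖b‖)`, so each term costs at most `φ(0)‖a - b‖`. -/
lemma IsJointMap.norm_sub_le (h : IsJointMap d φ) {a b : Vec d} (hle : ‖b‖ ≤ ‖a‖) :
    ‖φ ‖a‖ • a - φ ‖b‖ • b‖ ≤ 2 * φ 0 * ‖a - b‖ := by
  have ha := h.nonneg (norm_nonneg a)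
  have hmono := h.mul_monotoneOn_Ici (norm_nonneg b) (norm_nonneg a) hle
  have hanti := h.antitoneOn_Ici (norm_nonneg b) (norm_nonneg a) hle
  have h0 : φ ‖a‖ ≤ φ 0 := h.antitoneOn_Ici Set.self_mem_Ici (norm_nonneg a) (norm_nonneg a)
  have hsub : ‖a‖ - ‖b‖ ≤ ‖a - b‖ := norm_sub_norm_le a b
  have heq : φ ‖a‖ • a - φ ‖b‖ • b = φ ‖a‖ • (a - b) + (φ ‖a‖ - φ ‖b‖) • b := by
    module
  rw [heq]
  refine (norm_add_le _ _).trans ?_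
  rw [norm_smul, norm_smul, Real.norm_of_nonneg ha, Real.norm_of_nonpos (by linarith)]
  dsimp only at hmono
  nlinarith [mul_le_mul_of_nonneg_left hsub ha, mul_le_mul_of_nonneg_right h0 (norm_nonneg (a - b))]

lemma IsJointMap.isRegularOperator (h : IsJointMap d φ) (hΨ : ∀ x, Ψ x = φ ‖x‖ • x) :
    IsRegularOperator Ψ := by
  refine ⟨?_, ?_, ?_, ?_⟩
  · refine ⟨(2 * φ 0).toNNReal, LipschitzWith.of_dist_le_mul fun a b => ?_⟩
    rw [dist_eq_norm, dist_eq_norm, hΨ, hΨ, Real.coe_toNNReal _ (by linarith [h.zero_pos])]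
    rcases le_total ‖b‖ ‖a‖ with hle | hle
    · exact h.norm_sub_le hle
    · rw [norm_sub_rev, norm_sub_rev a b]
      exact h.norm_sub_le hle
  · intro a b
    rw [hΨ, hΨ]
    exact h.monotone_operator a b
  · intro a
    rw [hΨ, hΨ, norm_neg, smul_neg]
  · intro ε hε
    obtain ⟨M, s, hs, hlip⟩ := (h.contDiff.contDiffAt (x := 0)).exists_lipschitzOnWith
    have hev : ∀ᶠ x in nhds (0 : ℝ), x ∈ s ∧ φ 0 / 2 < φ x :=
      (Filter.eventually_mem_set.mpr hs).and
        (h.contDiff.continuous.continuousAt.eventually_const_lt (by linarith [h.zero_pos]))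
    obtain ⟨r, hr, hball⟩ := Metric.eventually_nhds_iff_ball.mp hev
    have h0 := h.zero_pos
    have hM : (0 : ℝ) ≤ M := M.2
    -- As `φ(0) > 0`, the origin can be the centre. Within this radius the polarised main term is at
    -- least `φ(0)/2 * ‖a - b‖²` and the cross term at most half of that.
    refine ⟨0, min r (φ 0 / (4 * (M + 1))), by positivity, φ 0 / 4, by positivity, by simpa, ?_⟩
    intro a ha b hb
    rw [mem_ball_zero_iff, lt_min_iff] at ha hb
    have hna := hball ‖a‖ (by simpa using ha.1)
    have hnb := hball ‖b‖ (by simpa using hb.1)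
    have hφ : |φ ‖a‖ - φ ‖b‖| ≤ M * |‖a‖ - ‖b‖| := by
      simpa [Real.dist_eq] using hlip.dist_le_mul _ hna.1 _ hnb.1
    have hrev : |‖a‖ - ‖b‖| ≤ ‖a - b‖ := abs_norm_sub_norm_le a b
    have hsum : M * (‖a‖ + ‖b‖) ≤ φ 0 / 2 := by
      have e : φ 0 / (4 * ((M : ℝ) + 1)) * (4 * (M + 1)) = φ 0 := by field_simp
      nlinarith [norm_nonneg a, norm_nonneg b]
    rw [hΨ, hΨ, inner_smul_sub_smul]
    have habs : |(φ ‖a‖ - φ ‖b‖) / 2 * (‖a‖ ^ 2 - ‖b‖ ^ 2)| ≤ φ 0 / 4 * ‖a - b‖ ^ 2 := by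
      have e : (φ ‖a‖ - φ ‖b‖) / 2 * (‖a‖ ^ 2 - ‖b‖ ^ 2)
          = (φ ‖a‖ - φ ‖b‖) * (‖a‖ - ‖b‖) * ((‖a‖ + ‖b‖) / 2) := by ring
      rw [e, abs_mul, abs_mul, abs_of_nonneg (by positivity : 0 ≤ (‖a‖ + ‖b‖) / 2)]
      calc |φ ‖a‖ - φ ‖b‖| * |‖a‖ - ‖b‖| * ((‖a‖ + ‖b‖) / 2)
          ≤ (M * |‖a‖ - ‖b‖|) * |‖a‖ - ‖b‖| * ((‖a‖ + ‖b‖) / 2) := by gcongr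
        _ = |‖a‖ - ‖b‖| ^ 2 * (M * (‖a‖ + ‖b‖) / 2) := by ring
        _ ≤ ‖a - b‖ ^ 2 * (φ 0 / 4) := by
            have : M * (‖a‖ + ‖b‖) / 2 ≤ φ 0 / 4 := by linarith
            gcongr
        _ = _ := by ring
    have := (abs_le.mp habs).1
    nlinarith [sq_nonneg ‖a - b‖, hna.2, hnb.2]

end Joint

lemma IsSmoothNonlinearity.isRegularOperator {d : ℕ} {Ψ : Vec d → Vec d}
    (h : IsSmoothNonlinearity Ψ) : IsRegularOperator Ψ := by
  rcases h with ⟨ψ, hψ, hΨ⟩ | ⟨φ, hφ, hΨ⟩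
  · exact hψ.isRegularOperator hΨ
  · exact hφ.isRegularOperator hΨ

/-! ### Symmetrised noise and the denoising inequality -/

lemma IsNoiseDensity.isProbabilityMeasure {d : ℕ} {P : Vec d → ℝ} {p σ : ℝ}
    (h : IsNoiseDensity P p σ) : IsProbabilityMeasure (densityLaw P) :=
  ⟨h.isProbability⟩

/-- The difference of two independent noise vectors charges every small ball near the origin. -/
lemma IsNoiseDensity.prod_sub_mem_ball_pos {d : ℕ} {P : Vec d → ℝ} {p σ : ℝ}
    (h : IsNoiseDensity P p σ) {E₀ : ℝ}
    (hE : ∀ x : Vec d, ‖x‖ ≤ E₀ → 0 < volume {y : Vec d | 0 < P y ∧ 0 < P (y - x)})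
    {w₀ : Vec d} {r : ℝ} (hr : 0 < r) (hw : ‖w₀‖ + r ≤ E₀) :
    0 < ((densityLaw P).prod (densityLaw P)) {w | w.1 - w.2 ∈ Metric.ball w₀ r} := by
  have hmP : Measurable P := h.measurable
  set S : Set (Vec d × Vec d) := {w | w.1 - w.2 ∈ Metric.ball w₀ r} with hS
  set T : Set (Vec d × Vec d) :=
    {w | w.1 - w.2 ∈ Metric.ball w₀ r ∧ 0 < P w.1 ∧ 0 < P w.2} with hT
  have hTm : MeasurableSet T := by
    refine ((measurable_fst.sub measurable_snd) measurableSet_ball).inter ?_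
    exact (measurableSet_lt measurable_const (hmP.comp measurable_fst)).inter
      (measurableSet_lt measurable_const (hmP.comp measurable_snd))
  have hprod : (densityLaw P).prod (densityLaw P) = ((volume : Measure (Vec d)).prod
      volume).withDensity fun w => ENNReal.ofReal (P w.1) * ENNReal.ofReal (P w.2) :=
    prod_withDensity hmP.ennreal_ofReal hmP.ennreal_ofReal
  -- The volume-preserving map `(x, y) ↦ (y, y - x)` pulls `T` back to a set whose slice over each
  -- `x` in the ball is the overlap set of `P` and its shift by `x`.
  have hTpos : 0 < ((volume : Measure (Vec d)).prod volume) T := by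
    have hmp := (measurePreserving_prod_sub_swap (volume : Measure (Vec d))
      (volume : Measure (Vec d)))
    have hmp2 : MeasurePreserving (fun z : Vec d × Vec d => (z.2, z.2 - z.1))
        ((volume : Measure (Vec d)).prod volume) ((volume : Measure (Vec d)).prod volume) := by
      have hneg : MeasurePreserving (fun z : Vec d × Vec d => (z.1, -z.2))
          ((volume : Measure (Vec d)).prod volume) ((volume : Measure (Vec d)).prod volume) :=
        (MeasurePreserving.id _).prod (Measure.measurePreserving_neg _)
      convert hneg.comp hmp using 1
      ext z : 1
      simp
    rw [← hmp2.measure_preimage hTm.nullMeasurableSet, pos_iff_ne_zero, ne_eq,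
      Measure.measure_prod_null (hmp2.measurable hTm)]
    intro hae
    have hball : 0 < volume (Metric.ball w₀ r) := Metric.measure_ball_pos _ _ hr
    refine hball.ne' (measure_mono_null ?_ hae)
    intro x hx
    refine (ne_of_gt ?_ : _ ≠ (0 : ENNReal))
    have hxE : ‖x‖ ≤ E₀ := by
      have h1 : ‖x - w₀‖ < r := by simpa [dist_eq_norm] using hx
      have h2 := norm_le_norm_add_norm_sub' x w₀
      linarith
    refine (hE x hxE).trans_le (measure_mono ?_)
    intro y hy
    simp only [hT, Set.mem_preimage, Set.mem_ofPred_eq, sub_sub_cancel]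
    exact ⟨hx, hy⟩
  rw [pos_iff_ne_zero]
  intro h0
  rw [hprod, withDensity_apply_eq_zero (by fun_prop)] at h0
  refine hTpos.ne' (measure_mono_null ?_ h0)
  intro w hw
  refine ⟨?_, hw.1⟩
  have h1 := hw.2.1
  have h2 := hw.2.2
  simp [h1, h2]

section Denoised
variable {d : ℕ} {Ψ : Vec d → Vec d}

/-- Along rays, monotone operators have non-decreasing symmetric increments. -/
lemma IsRegularOperator.inner_increment_mono (h : IsRegularOperator Ψ) (w u : Vec d) {s : ℝ}
    (hs1 : s ≤ 1) :
    inner ℝ (Ψ (w + s • u) - Ψ (w - s • u)) u ≤ inner ℝ (Ψ (w + u) - Ψ (w - u)) u := by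
  rcases hs1.eq_or_lt with rfl | hs
  · simp
  have h1 := h.monotone (w + u) (w + s • u)
  have h2 := h.monotone (w - s • u) (w - u)
  rw [show w + u - (w + s • u) = (1 - s) • u by module, real_inner_smul_right] at h1
  rw [show w - s • u - (w - u) = (1 - s) • u by module, real_inner_smul_right] at h2
  have h3 := nonneg_of_mul_nonneg_right h1 (by linarith)
  have h4 := nonneg_of_mul_nonneg_right h2 (by linarith)
  rw [inner_sub_left] at h3 h4 ⊢
  rw [inner_sub_left]
  linarith

lemma IsRegularOperator.inner_increment_nonneg (h : IsRegularOperator Ψ) (w u : Vec d) :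
    0 ≤ inner ℝ (Ψ (w + u) - Ψ (w - u)) u := by
  simpa using h.inner_increment_mono w u (s := 0) (by norm_num)

/-- For `‖u‖ ≤ r/4` both `w ± u` lie in the strong monotonicity ball. A longer `u` is shrunk to
length `r/4` along its ray, which turns the quadratic bound into a linear one. -/
lemma IsRegularOperator.inner_increment_ge (h : IsRegularOperator Ψ) {w₀ : Vec d} {r κ : ℝ}
    (hr : 0 < r)
    (hstrong : ∀ a ∈ Metric.ball w₀ r, ∀ b ∈ Metric.ball w₀ r,
      κ * ‖a - b‖ ^ 2 ≤ inner ℝ (Ψ a - Ψ b) (a - b))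
    {w : Vec d} (hw : w ∈ Metric.ball w₀ (r / 2)) (u : Vec d) :
    2 * min (κ * r / 4 * ‖u‖) (κ * ‖u‖ ^ 2) ≤ inner ℝ (Ψ (w + u) - Ψ (w - u)) u := by
  have hw' : ‖w - w₀‖ < r / 2 := by simpa [dist_eq_norm] using hw
  have small : ∀ v : Vec d, ‖v‖ ≤ r / 4 →
      2 * (κ * ‖v‖ ^ 2) ≤ inner ℝ (Ψ (w + v) - Ψ (w - v)) v := by
    intro v hv
    have hp : w + v ∈ Metric.ball w₀ r := by
      rw [Metric.mem_ball, dist_eq_norm, show w + v - w₀ = (w - w₀) + v by abel]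
      linarith [norm_add_le (w - w₀) v]
    have hm : w - v ∈ Metric.ball w₀ r := by
      rw [Metric.mem_ball, dist_eq_norm, show w - v - w₀ = (w - w₀) - v by abel]
      linarith [norm_sub_le (w - w₀) v]
    have := hstrong _ hp _ hm
    rw [show w + v - (w - v) = (2 : ℝ) • v by module, norm_smul, real_inner_smul_right,
      Real.norm_of_nonneg (by norm_num)] at this
    linarith
  rcases le_or_gt ‖u‖ (r / 4) with hu | hu
  · exact (mul_le_mul_of_nonneg_left (min_le_right _ _) (by norm_num)).trans (small u hu)
  · have hu0 : 0 < ‖u‖ := (by positivity : 0 < r / 4).trans hu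
    set s : ℝ := r / 4 / ‖u‖ with hs
    have hs0 : 0 < s := by positivity
    have hsu : s * ‖u‖ = r / 4 := div_mul_cancel₀ _ hu0.ne'
    have hs1 : s ≤ 1 := (div_le_one hu0).mpr hu.le
    have hn : ‖s • u‖ = r / 4 := by rw [norm_smul, Real.norm_of_nonneg hs0.le, hsu]
    have h1 := small (s • u) hn.le
    rw [hn, real_inner_smul_right] at h1
    have h2 := h.inner_increment_mono w u hs1
    refine (mul_le_mul_of_nonneg_left (min_le_left _ _) (by norm_num)).trans (le_trans ?_ h2)
    refine le_of_mul_le_mul_left ?_ hs0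
    calc s * (2 * (κ * r / 4 * ‖u‖)) = 2 * (κ * r / 4 * (s * ‖u‖)) := by ring
      _ = 2 * (κ * (r / 4) ^ 2) := by rw [hsu]; ring
      _ ≤ _ := h1

/-- The symmetrised form of the pairing of the denoised nonlinearity with its argument. -/
lemma two_mul_inner_denoised {P : Vec d → ℝ} [IsProbabilityMeasure (densityLaw P)]
    (h : IsRegularOperator Ψ) {C : ℝ} (hC : ∀ x, ‖Ψ x‖ ≤ C) (u : Vec d) :
    2 * inner ℝ (denoised Ψ P u) u = ∫ w : Vec d × Vec d,
      inner ℝ (Ψ ((w.1 - w.2) + u) - Ψ ((w.1 - w.2) - u)) u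
        ∂((densityLaw P).prod (densityLaw P)) := by
  obtain ⟨K, hK⟩ := h.lipschitz
  have hcont : Continuous Ψ := hK.continuous
  set ρ := (densityLaw P).prod (densityLaw P)
  have hint : ∀ v : Vec d, Integrable (fun w : Vec d × Vec d => Ψ ((w.1 - w.2) + v)) ρ :=
    fun v => Integrable.of_bound (by fun_prop : Continuous _).aestronglyMeasurable C
      (Filter.Eventually.of_forall fun _ => hC _)
  have e1 : denoised Ψ P u = ∫ w : Vec d × Vec d, Ψ ((w.1 - w.2) + u) ∂ρ := by
    unfold denoised
    simp_rw [add_comm u]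
    rfl
  -- Swapping the two noise vectors negates their difference; oddness of `Ψ` moves the sign outside.
  have e2 : denoised Ψ P u = -∫ w : Vec d × Vec d, Ψ ((w.1 - w.2) - u) ∂ρ := by
    rw [e1, ← integral_prod_swap, ← integral_neg]
    refine integral_congr_ae (Filter.Eventually.of_forall fun w => ?_)
    simp only [Prod.fst_swap, Prod.snd_swap]
    rw [← h.odd]
    congr 1
    abel
  have hint' : Integrable (fun w : Vec d × Vec d => Ψ ((w.1 - w.2) - u)) ρ := by
    simpa [sub_eq_add_neg] using hint (-u)
  have e3 : (2 : ℝ) • denoised Ψ P u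
      = ∫ w : Vec d × Vec d, (Ψ ((w.1 - w.2) + u) - Ψ ((w.1 - w.2) - u)) ∂ρ := by
    rw [integral_sub (hint u) hint', ← e1, two_smul, sub_eq_add_neg, ← e2]
  have hdiff : Integrable
      (fun w : Vec d × Vec d => Ψ ((w.1 - w.2) + u) - Ψ ((w.1 - w.2) - u)) ρ :=
    (hint u).sub hint'
  rw [← real_inner_smul_left, e3, real_inner_comm, ← integral_inner hdiff]
  simp_rw [real_inner_comm u]

theorem exists_areDenoisingConstants {P : Vec d → ℝ} {p σ C : ℝ} (h : IsRegularOperator Ψ)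
    (hP : IsNoiseDensity P p σ) (hC : ∀ x, ‖Ψ x‖ ≤ C) :
    ∃ γ₁ γ₂ : ℝ, AreDenoisingConstants Ψ P γ₁ γ₂ := by
  have := hP.isProbabilityMeasure
  obtain ⟨E₀, hE₀, hE⟩ := hP.overlap
  -- Centre within `E₀/2` and, below, radius at most `E₀/2`: the ball stays inside the range of the
  -- overlap condition.
  obtain ⟨w₀, r, hr, κ, hκ, hw₀, hstrong⟩ := h.local_strong (E₀ / 2) (by positivity)
  set r' := min r E₀ with hr'
  have hr'0 : 0 < r' := lt_min hr hE₀
  have hstrong' : ∀ a ∈ Metric.ball w₀ r', ∀ b ∈ Metric.ball w₀ r',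
      κ * ‖a - b‖ ^ 2 ≤ inner ℝ (Ψ a - Ψ b) (a - b) := fun a ha b hb =>
    hstrong a (Metric.ball_subset_ball (min_le_left _ _) ha) b
      (Metric.ball_subset_ball (min_le_left _ _) hb)
  set ρ := (densityLaw P).prod (densityLaw P) with hρ
  set S : Set (Vec d × Vec d) := {w | w.1 - w.2 ∈ Metric.ball w₀ (r' / 2)} with hS
  have hSm : MeasurableSet S := (measurable_fst.sub measurable_snd) measurableSet_ball
  have hSpos : 0 < ρ S := hP.prod_sub_mem_ball_pos hE (by positivity)
    (by linarith [min_le_right r E₀])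
  have hq : 0 < ρ.real S := ENNReal.toReal_pos hSpos.ne' (measure_ne_top _ _)
  obtain ⟨K, hK⟩ := h.lipschitz
  have hcont : Continuous Ψ := hK.continuous
  refine ⟨ρ.real S * (κ * r' / 4), ρ.real S * κ, by positivity, by positivity, fun u => ?_⟩
  set m := min (κ * r' / 4 * ‖u‖) (κ * ‖u‖ ^ 2) with hm
  have hint : Integrable (fun w : Vec d × Vec d =>
      inner ℝ (Ψ ((w.1 - w.2) + u) - Ψ ((w.1 - w.2) - u)) u) ρ := by
    refine Integrable.of_bound (by fun_prop : Continuous _).aestronglyMeasurable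
      ((C + C) * ‖u‖) (Filter.Eventually.of_forall fun w => ?_)
    refine (norm_inner_le_norm _ _).trans ?_
    gcongr
    exact (norm_sub_le _ _).trans (add_le_add (hC _) (hC _))
  have key : ρ.real S * (2 * m) ≤ 2 * inner ℝ (denoised Ψ P u) u := by
    rw [two_mul_inner_denoised h hC]
    calc ρ.real S * (2 * m) = ∫ _ in S, 2 * m ∂ρ := by simp
      _ ≤ ∫ w in S, inner ℝ (Ψ ((w.1 - w.2) + u) - Ψ ((w.1 - w.2) - u)) u ∂ρ :=
          setIntegral_mono_on (integrable_const _).integrableOn hint.integrableOn hSm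
            fun w hw => h.inner_increment_ge hr'0 hstrong' hw u
      _ ≤ _ := setIntegral_le_integral hint
          (Filter.Eventually.of_forall fun w => h.inner_increment_nonneg _ u)
  calc min (ρ.real S * (κ * r' / 4) * ‖u‖) (ρ.real S * κ * ‖u‖ ^ 2) = ρ.real S * m := by
        rw [hm, mul_min_of_nonneg _ _ hq.le, mul_assoc, mul_assoc]
    _ ≤ _ := by linarith

end Denoised

/-! ### First moments of heavy-tailed batch means -/

section BatchMean
variable {d : ℕ} {Ω : Type*} [MeasurableSpace Ω] {μ : Measure Ω} [IsProbabilityMeasure μ]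

/-- The variance of a sum of pairwise independent bounded vectors. -/
lemma integral_norm_sum_sub_sq_le {ι : Type*} {s : Finset ι} {Y : ι → Ω → Vec d} {τ : ℝ}
    (hm : ∀ i ∈ s, Measurable (Y i)) (hb : ∀ i ∈ s, ∀ ω, ‖Y i ω‖ ≤ τ)
    (hind : Set.Pairwise (s : Set ι) fun i j => IndepFun (Y i) (Y j) μ) :
    ∫ ω, ‖∑ i ∈ s, (Y i ω - ∫ ω', Y i ω' ∂μ)‖ ^ 2 ∂μ ≤ ∑ i ∈ s, ∫ ω, ‖Y i ω‖ ^ 2 ∂μ := by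
  have hmk : ∀ i ∈ s, ∀ k, Measurable fun ω => Y i ω k := fun i hi k =>
    (EuclideanSpace.proj (𝕜 := ℝ) k).continuous.measurable.comp (hm i hi)
  have hbk : ∀ i ∈ s, ∀ k, ∀ ω, ‖Y i ω k‖ ≤ τ := fun i hi k ω =>
    (PiLp.norm_apply_le (Y i ω) k).trans (hb i hi ω)
  have hL : ∀ i ∈ s, ∀ k, MemLp (fun ω => Y i ω k) 2 μ := fun i hi k =>
    MemLp.of_bound (hmk i hi k).aestronglyMeasurable τ (Filter.Eventually.of_forall (hbk i hi k))
  have hint : ∀ i ∈ s, Integrable (Y i) μ := fun i hi =>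
    Integrable.of_bound (hm i hi).aestronglyMeasurable τ (Filter.Eventually.of_forall (hb i hi))
  have hcoord : ∀ i ∈ s, ∀ k, (∫ ω', Y i ω' ∂μ) k = ∫ ω', Y i ω' k ∂μ := fun i hi k =>
    ((EuclideanSpace.proj (𝕜 := ℝ) k).integral_comp_comm (hint i hi)).symm
  have hvar : ∀ k, ∫ ω, (∑ i ∈ s, (Y i ω k - ∫ ω', Y i ω' k ∂μ)) ^ 2 ∂μ
      = ∑ i ∈ s, variance (fun ω => Y i ω k) μ := by
    intro k
    have hpair : Set.Pairwise (s : Set ι) fun i j =>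
        IndepFun (fun ω => Y i ω k) (fun ω => Y j ω k) μ := fun i hi j hj hij =>
      (hind hi hj hij).comp (EuclideanSpace.proj (𝕜 := ℝ) k).continuous.measurable
        (EuclideanSpace.proj (𝕜 := ℝ) k).continuous.measurable
    rw [← IndepFun.variance_sum (fun i hi => hL i hi k) hpair, variance_eq_integral
      (Finset.aemeasurable_sum _ fun i hi => (hmk i hi k).aemeasurable)]
    refine integral_congr_ae (Filter.Eventually.of_forall fun ω => ?_)
    simp only [Finset.sum_apply, Finset.sum_sub_distrib]
    rw [integral_finsetSum _ fun i hi => (hL i hi k).integrable (by norm_num)]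
  have hsq : ∀ i ∈ s, ∀ k, Integrable (fun ω => Y i ω k ^ 2) μ := fun i hi k =>
    (hL i hi k).integrable_sq
  have hSL : ∀ k, Integrable (fun ω => (∑ i ∈ s, (Y i ω k - ∫ ω', Y i ω' k ∂μ)) ^ 2) μ :=
    fun k => (memLp_finsetSum s fun i hi => (hL i hi k).sub (memLp_const _)).integrable_sq
  calc ∫ ω, ‖∑ i ∈ s, (Y i ω - ∫ ω', Y i ω' ∂μ)‖ ^ 2 ∂μ
      = ∫ ω, ∑ k, (∑ i ∈ s, (Y i ω k - ∫ ω', Y i ω' k ∂μ)) ^ 2 ∂μ := by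
        refine integral_congr_ae (Filter.Eventually.of_forall fun ω => ?_)
        simp only [EuclideanSpace.norm_sq_eq, Real.norm_eq_abs, sq_abs]
        refine Finset.sum_congr rfl fun k _ => ?_
        simp only [WithLp.ofLp_sum, Finset.sum_apply, PiLp.sub_apply]
        congr 1
        exact Finset.sum_congr rfl fun i hi => by rw [hcoord i hi k]
    _ = ∑ k, ∑ i ∈ s, variance (fun ω => Y i ω k) μ := by
        rw [integral_finsetSum _ fun k _ => hSL k]
        exact Finset.sum_congr rfl fun k _ => hvar k
    _ ≤ ∑ k, ∑ i ∈ s, ∫ ω, Y i ω k ^ 2 ∂μ := by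
        gcongr with k _ i hi
        exact variance_le_expectation_sq (hmk i hi k).aestronglyMeasurable
    _ = ∑ i ∈ s, ∫ ω, ‖Y i ω‖ ^ 2 ∂μ := by
        rw [Finset.sum_comm]
        refine Finset.sum_congr rfl fun i hi => ?_
        rw [← integral_finsetSum _ fun k _ => hsq i hi k]
        simp [EuclideanSpace.norm_sq_eq]

lemma integral_le_sqrt_integral_sq {X : Ω → ℝ} (hX : MemLp X 2 μ) :
    ∫ ω, X ω ∂μ ≤ √(∫ ω, X ω ^ 2 ∂μ) := by
  refine Real.le_sqrt_of_sq_le ?_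
  have h := variance_nonneg X μ
  rw [variance_eq_sub hX] at h
  simpa using h

/-- `z` if `‖z‖ ≤ τ`, and `0` otherwise. -/
def truncate (τ : ℝ) (z : Vec d) : Vec d := (Metric.closedBall 0 τ).indicator id z

lemma measurable_truncate (τ : ℝ) : Measurable (truncate τ : Vec d → Vec d) :=
  measurable_id.indicator Metric.isClosed_closedBall.measurableSet

lemma norm_truncate_le {τ : ℝ} (hτ : 0 ≤ τ) (z : Vec d) : ‖truncate τ z‖ ≤ τ := by
  unfold truncate
  by_cases h : z ∈ Metric.closedBall (0 : Vec d) τ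
  · simpa [Set.indicator_of_mem h] using h
  · simpa [Set.indicator_of_notMem h] using hτ

lemma norm_truncate_sq_le {τ p : ℝ} (hτ : 0 < τ) (hp : 1 < p) (hp2 : p ≤ 2) (z : Vec d) :
    ‖truncate τ z‖ ^ 2 ≤ τ ^ (2 - p) * ‖z‖ ^ p := by
  unfold truncate
  by_cases h : z ∈ Metric.closedBall (0 : Vec d) τ
  · rw [Set.indicator_of_mem h, id]
    have hz : ‖z‖ ≤ τ := by simpa using h
    rcases (norm_nonneg z).eq_or_lt with h0 | h0
    · rw [← h0, Real.zero_rpow (by linarith)]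
      simp
    calc ‖z‖ ^ 2 = ‖z‖ ^ (2 - p) * ‖z‖ ^ p := by
          rw [← Real.rpow_add h0, sub_add_cancel, Real.rpow_two]
      _ ≤ _ := by
          gcongr
  · rw [Set.indicator_of_notMem h]
    simp only [norm_zero, ne_eq, OfNat.ofNat_ne_zero, not_false_eq_true, zero_pow]
    positivity

lemma norm_sub_truncate_le {τ p : ℝ} (hτ : 0 < τ) (hp : 1 < p) (z : Vec d) :
    ‖z - truncate τ z‖ ≤ τ ^ (1 - p) * ‖z‖ ^ p := by
  unfold truncate
  by_cases h : z ∈ Metric.closedBall (0 : Vec d) τ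
  · rw [Set.indicator_of_mem h, id, sub_self, norm_zero]
    positivity
  · rw [Set.indicator_of_notMem h, sub_zero]
    have hz : τ < ‖z‖ := by simpa using h
    have h0 : 0 < ‖z‖ := hτ.trans hz
    calc ‖z‖ = ‖z‖ ^ (1 - p) * ‖z‖ ^ p := by
          rw [← Real.rpow_add h0, sub_add_cancel, Real.rpow_one]
      _ ≤ _ := by
          gcongr ?_ * _
          exact Real.rpow_le_rpow_of_nonpos hτ hz.le (by linarith)

/-- A first-moment bound for sums of independent centred vectors with finite `p`-th moments. -/
lemma integral_norm_sum_le {ι : Type*} {s : Finset ι} {Z : ι → Ω → Vec d} {p σ : ℝ}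
    (hp : 1 < p) (hp2 : p ≤ 2) (hσ : 0 < σ) (hm : ∀ i ∈ s, Measurable (Z i))
    (hint : ∀ i ∈ s, Integrable (Z i) μ) (hzero : ∀ i ∈ s, ∫ ω, Z i ω ∂μ = 0)
    (hpint : ∀ i ∈ s, Integrable (fun ω => ‖Z i ω‖ ^ p) μ)
    (hpmom : ∀ i ∈ s, ∫ ω, ‖Z i ω‖ ^ p ∂μ ≤ σ ^ p)
    (hind : Set.Pairwise (s : Set ι) fun i j => IndepFun (Z i) (Z j) μ) :
    ∫ ω, ‖∑ i ∈ s, Z i ω‖ ∂μ ≤ 3 * σ * (s.card : ℝ) ^ (1 / p) := by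
  rcases s.eq_empty_or_nonempty with rfl | hs
  · simp only [Finset.sum_empty, norm_zero, integral_zero]
    positivity
  set n : ℝ := (s.card : ℝ) with hn
  have hn0 : 0 < n := by simpa [hn] using hs
  -- This level balances the two errors: the root mean square of the centred truncated sum and the
  -- summed first moments of the tails are both at most `τ`.
  set τ : ℝ := σ * n ^ (1 / p) with hτdef
  have hτ : 0 < τ := by positivity
  have hτp : τ ^ p = σ ^ p * n := by
    rw [hτdef, Real.mul_rpow hσ.le (by positivity), ← Real.rpow_mul hn0.le,
      one_div_mul_cancel (by linarith), Real.rpow_one]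
  set T : ι → Ω → Vec d := fun i ω => truncate τ (Z i ω) with hT
  have hTm : ∀ i ∈ s, Measurable (T i) := fun i hi => (measurable_truncate τ).comp (hm i hi)
  have hTb : ∀ i ∈ s, ∀ ω, ‖T i ω‖ ≤ τ := fun i _ ω => norm_truncate_le hτ.le _
  have hTint : ∀ i ∈ s, Integrable (T i) μ := fun i hi =>
    Integrable.of_bound (hTm i hi).aestronglyMeasurable τ (Filter.Eventually.of_forall (hTb i hi))
  set c : ι → Vec d := fun i => ∫ ω, T i ω ∂μ with hc
  set U : Ω → Vec d := fun ω => ∑ i ∈ s, (T i ω - c i) with hU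
  set V : Ω → Vec d := fun ω => ∑ i ∈ s, (Z i ω - T i ω + c i) with hV
  have hUm : Measurable U := Finset.measurable_sum _ fun i hi => (hTm i hi).sub_const _
  have hUL : MemLp (fun ω => ‖U ω‖) 2 μ := by
    have : MemLp U 2 μ := memLp_finsetSum s fun i hi => (MemLp.of_bound
      (hTm i hi).aestronglyMeasurable τ (Filter.Eventually.of_forall (hTb i hi))).sub
        (memLp_const _)
    exact this.norm
  have hRint : ∀ i ∈ s, Integrable (fun ω => Z i ω - T i ω) μ := fun i hi =>
    (hint i hi).sub (hTint i hi)
  have hR : ∀ i ∈ s, ∫ ω, ‖Z i ω - T i ω‖ ∂μ ≤ τ ^ (1 - p) * σ ^ p := by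
    intro i hi
    calc ∫ ω, ‖Z i ω - T i ω‖ ∂μ ≤ ∫ ω, τ ^ (1 - p) * ‖Z i ω‖ ^ p ∂μ :=
          integral_mono (hRint i hi).norm ((hpint i hi).const_mul _)
            fun ω => norm_sub_truncate_le hτ hp _
      _ = τ ^ (1 - p) * ∫ ω, ‖Z i ω‖ ^ p ∂μ := integral_const_mul _ _
      _ ≤ _ := by gcongr; exact hpmom i hi
  have hτ1 : n * (τ ^ (1 - p) * σ ^ p) = τ := by
    calc n * (τ ^ (1 - p) * σ ^ p) = τ ^ (1 - p) * τ ^ p := by rw [hτp]; ring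
      _ = τ := by rw [← Real.rpow_add hτ, sub_add_cancel, Real.rpow_one]
  have hτ2 : n * (τ ^ (2 - p) * σ ^ p) = τ ^ 2 := by
    calc n * (τ ^ (2 - p) * σ ^ p) = τ ^ (2 - p) * τ ^ p := by rw [hτp]; ring
      _ = τ ^ 2 := by rw [← Real.rpow_add hτ, sub_add_cancel, Real.rpow_two]
  have hUle : ∫ ω, ‖U ω‖ ∂μ ≤ τ := by
    refine (integral_le_sqrt_integral_sq hUL).trans (Real.sqrt_le_iff.mpr ⟨hτ.le, ?_⟩)
    refine (integral_norm_sum_sub_sq_le hTm hTb fun i hi j hj hij =>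
      (hind hi hj hij).comp (measurable_truncate τ) (measurable_truncate τ)).trans ?_
    calc ∑ i ∈ s, ∫ ω, ‖T i ω‖ ^ 2 ∂μ ≤ ∑ _i ∈ s, τ ^ (2 - p) * σ ^ p := by
          refine Finset.sum_le_sum fun i hi => ?_
          calc ∫ ω, ‖T i ω‖ ^ 2 ∂μ ≤ ∫ ω, τ ^ (2 - p) * ‖Z i ω‖ ^ p ∂μ :=
                integral_mono_of_nonneg (Filter.Eventually.of_forall fun ω => by positivity)
                  ((hpint i hi).const_mul _)
                  (Filter.Eventually.of_forall fun ω => norm_truncate_sq_le hτ hp hp2 _)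
            _ = τ ^ (2 - p) * ∫ ω, ‖Z i ω‖ ^ p ∂μ := integral_const_mul _ _
            _ ≤ _ := by gcongr; exact hpmom i hi
      _ = τ ^ 2 := by rw [Finset.sum_const, nsmul_eq_mul, ← hn, hτ2]
  have hcR : ∀ i ∈ s, ‖c i‖ ≤ τ ^ (1 - p) * σ ^ p := by
    intro i hi
    -- The noise is centred, so the mean of the truncated part is minus that of the tail and is no
    -- larger than the tail moment; hence the factor `2` for `V`.
    have : c i = -∫ ω, (Z i ω - T i ω) ∂μ := by
      rw [integral_sub (hint i hi) (hTint i hi), hzero i hi, zero_sub, neg_neg]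
    rw [this, norm_neg]
    exact (norm_integral_le_integral_norm _).trans (hR i hi)
  have hVint' : ∀ i ∈ s, Integrable (fun ω => Z i ω - T i ω + c i) μ := fun i hi =>
    (hRint i hi).add (integrable_const _)
  have hVle : ∫ ω, ‖V ω‖ ∂μ ≤ 2 * τ := by
    calc ∫ ω, ‖V ω‖ ∂μ ≤ ∫ ω, ∑ i ∈ s, ‖Z i ω - T i ω + c i‖ ∂μ :=
          integral_mono (integrable_finsetSum _ hVint').norm
            (integrable_finsetSum _ fun i hi => (hVint' i hi).norm) fun ω => norm_sum_le _ _
      _ = ∑ i ∈ s, ∫ ω, ‖Z i ω - T i ω + c i‖ ∂μ :=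
          integral_finsetSum _ fun i hi => (hVint' i hi).norm
      _ ≤ ∑ _i ∈ s, 2 * (τ ^ (1 - p) * σ ^ p) := by
          refine Finset.sum_le_sum fun i hi => ?_
          calc ∫ ω, ‖Z i ω - T i ω + c i‖ ∂μ ≤ ∫ ω, (‖Z i ω - T i ω‖ + ‖c i‖) ∂μ :=
                integral_mono (hVint' i hi).norm ((hRint i hi).norm.add (integrable_const _))
                  fun ω => norm_add_le _ _
            _ = ∫ ω, ‖Z i ω - T i ω‖ ∂μ + ‖c i‖ := by
                rw [integral_add (hRint i hi).norm (integrable_const _)]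
                simp
            _ ≤ _ := by linarith [hR i hi, hcR i hi]
      _ = 2 * τ := by
          rw [Finset.sum_const, nsmul_eq_mul, ← hn]
          linarith
  have hVint : Integrable V μ := integrable_finsetSum _ hVint'
  have hUint : Integrable (fun ω => ‖U ω‖) μ := hUL.integrable (by norm_num)
  calc ∫ ω, ‖∑ i ∈ s, Z i ω‖ ∂μ = ∫ ω, ‖U ω + V ω‖ ∂μ := by
        refine integral_congr_ae (Filter.Eventually.of_forall fun ω => ?_)
        simp only [hU, hV, ← Finset.sum_add_distrib]
        congr 1
        exact Finset.sum_congr rfl fun i _ => by abel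
    _ ≤ ∫ ω, (‖U ω‖ + ‖V ω‖) ∂μ :=
        integral_mono_of_nonneg (Filter.Eventually.of_forall fun ω => norm_nonneg _)
          (hUint.add hVint.norm) (Filter.Eventually.of_forall fun ω => norm_add_le _ _)
    _ = ∫ ω, ‖U ω‖ ∂μ + ∫ ω, ‖V ω‖ ∂μ := integral_add hUint hVint.norm
    _ ≤ 3 * σ * n ^ (1 / p) := by
        have : 3 * σ * n ^ (1 / p) = 3 * τ := by rw [hτdef]; ring
        linarith

lemma IsNoiseDensity.integrable_rpow {P : Vec d → ℝ} {p σ : ℝ} (h : IsNoiseDensity P p σ) :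
    Integrable (fun z : Vec d => ‖z‖ ^ p) (densityLaw P) := by
  refine ⟨(measurable_norm.pow_const p).aestronglyMeasurable, ?_⟩
  refine lt_of_le_of_lt (le_of_eq ?_) (h.moment.trans_lt ENNReal.ofReal_lt_top)
  refine lintegral_congr fun z => ?_
  rw [Real.enorm_of_nonneg (by positivity), ← ofReal_norm,
    ENNReal.ofReal_rpow_of_nonneg (norm_nonneg _) (by linarith [h.one_lt])]

lemma IsNoiseDensity.integral_rpow_le {P : Vec d → ℝ} {p σ : ℝ} (h : IsNoiseDensity P p σ) :
    ∫ z, ‖z‖ ^ p ∂(densityLaw P) ≤ σ ^ p := by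
  rw [integral_eq_lintegral_of_nonneg_ae (Filter.Eventually.of_forall fun z => by positivity)
    h.integrable_rpow.aestronglyMeasurable]
  refine ENNReal.toReal_le_of_le_ofReal (Real.rpow_nonneg h.sigma_pos.le _)
    (le_trans (le_of_eq ?_) h.moment)
  refine lintegral_congr fun z => ?_
  rw [← ofReal_norm, ENNReal.ofReal_rpow_of_nonneg (norm_nonneg _) (by linarith [h.one_lt])]

lemma IsNoiseDensity.integrable_id {P : Vec d → ℝ} {p σ : ℝ} (h : IsNoiseDensity P p σ) :
    Integrable (fun z : Vec d => z) (densityLaw P) := by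
  have := h.isProbabilityMeasure
  refine Integrable.mono' ((integrable_const (1 : ℝ)).add h.integrable_rpow)
    measurable_id.aestronglyMeasurable (Filter.Eventually.of_forall fun z => ?_)
  rcases le_total ‖z‖ 1 with hz | hz
  · have : 0 ≤ ‖z‖ ^ p := by positivity
    simp only [Pi.add_apply]
    linarith
  · have := Real.self_le_rpow_of_one_le hz h.one_lt.le
    simp only [Pi.add_apply]
    linarith

lemma batchSize_pos (p : ℝ) {t : ℕ} (ht : 1 ≤ t) : 0 < batchSize p t := by
  unfold batchSize
  have : (0 : ℝ) < t := by exact_mod_cast ht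
  positivity

/-- The batch sizes compensate the heavy tails: batch means have first moment `O(t^{-1/2})`. -/
lemma batchSize_rpow_le {p : ℝ} (hp : 1 < p) {t : ℕ} (ht : 1 ≤ t) :
    (batchSize p t : ℝ) ^ (1 / p) / batchSize p t ≤ 1 / √t := by
  have ht0 : (0 : ℝ) < t := by exact_mod_cast ht
  have hB : (0 : ℝ) < batchSize p t := by exact_mod_cast batchSize_pos p ht
  have hle : (t : ℝ) ^ (p / (2 * (p - 1))) ≤ batchSize p t := Nat.le_ceil _
  have hp0 : 0 < p := by linarith
  have hp1 : 0 < p - 1 := by linarith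
  have e1 : (batchSize p t : ℝ) ^ (1 / p) / batchSize p t
      = ((batchSize p t : ℝ)) ^ (1 / p - 1) := by
    rw [Real.rpow_sub hB, Real.rpow_one]
  rw [e1]
  -- The exponent `1/p - 1` is negative, so rounding the batch size up only helps, and `p/(2(p-1)) *
  -- (1/p - 1) = -1/2`.
  calc (batchSize p t : ℝ) ^ (1 / p - 1)
      ≤ ((t : ℝ) ^ (p / (2 * (p - 1)))) ^ (1 / p - 1) := by
        refine Real.rpow_le_rpow_of_nonpos (by positivity) hle ?_
        rw [sub_nonpos, div_le_one hp0]
        exact hp.le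
    _ = (t : ℝ) ^ (-(1 / 2) : ℝ) := by
        rw [← Real.rpow_mul ht0.le]
        congr 1
        field_simp
        ring
    _ = 1 / √t := by rw [Real.rpow_neg ht0.le, ← Real.sqrt_eq_rpow, one_div]

end BatchMean

/-! ### The descent inequality -/

section Smooth
variable {d : ℕ} {F : Vec d → ℝ} {L : ℝ}

lemma IsSmoothObjective.le_quadratic (hF : IsSmoothObjective F L) (x v : Vec d) :
    F (x + v) ≤ F x + inner ℝ (gradient F x) v + L / 2 * ‖v‖ ^ 2 := by
  set h : ℝ → ℝ := fun s => F (x + s • v) - s * inner ℝ (gradient F x) v - L / 2 * s ^ 2 * ‖v‖ ^ 2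
    with hh
  have hder : ∀ s : ℝ, HasDerivAt h (inner ℝ (gradient F (x + s • v)) v
      - inner ℝ (gradient F x) v - L * s * ‖v‖ ^ 2) s := by
    intro s
    have h1 : HasDerivAt (fun s : ℝ => x + s • v) v s := by
      simpa using ((hasDerivAt_id s).smul_const v).const_add x
    have h2 := (hF.differentiable (x + s • v)).hasGradientAt.hasFDerivAt.comp_hasDerivAt s h1
    have h3 : HasDerivAt (fun s : ℝ => s * inner ℝ (gradient F x) v)
        (inner ℝ (gradient F x) v) s := by
      simpa using (hasDerivAt_id s).mul_const (inner ℝ (gradient F x) v)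
    have h4 : HasDerivAt (fun s : ℝ => L / 2 * s ^ 2 * ‖v‖ ^ 2) (L * s * ‖v‖ ^ 2) s := by
      have := (((hasDerivAt_id s).pow 2).const_mul (L / 2)).mul_const (‖v‖ ^ 2)
      refine this.congr_deriv ?_
      simp only [id_eq, Nat.cast_ofNat, Nat.add_one_sub_one, pow_one, mul_one]
      ring
    exact (h2.sub h3).sub h4
  have hanti : AntitoneOn h (Set.Icc 0 1) := by
    refine antitoneOn_of_deriv_nonpos (convex_Icc 0 1)
      (fun s _ => (hder s).continuousAt.continuousWithinAt)
      (fun s _ => (hder s).differentiableAt.differentiableWithinAt) fun s hs => ?_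
    rw [interior_Icc] at hs
    rw [(hder s).deriv, ← inner_sub_left]
    have h1 := real_inner_le_norm (gradient F (x + s • v) - gradient F x) v
    have h2 := hF.lipschitz (x + s • v) x
    rw [add_sub_cancel_left, norm_smul, Real.norm_of_nonneg hs.1.le] at h2
    nlinarith [mul_le_mul_of_nonneg_right h2 (norm_nonneg v)]
  have := hanti (Set.left_mem_Icc.mpr zero_le_one) (Set.right_mem_Icc.mpr zero_le_one) zero_le_one
  simp only [hh, one_smul, zero_smul, add_zero] at this
  linarith

lemma IsSmoothObjective.continuous_gradient (hF : IsSmoothObjective F L) (hL : 0 < L) :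
    Continuous (gradient F) :=
  (LipschitzWith.of_dist_le_mul (K := L.toNNReal) fun x y => by
    rw [dist_eq_norm, dist_eq_norm, Real.coe_toNNReal L hL.le]
    exact hF.lipschitz x y).continuous

end Smooth

lemma stepSize_half (a : ℝ) (t : ℕ) : stepSize a (1 / 2) t = a / √((t : ℝ) + 1) := by
  rw [stepSize, Real.sqrt_eq_rpow]

/-! ### Exponential moments and independence -/

section Probability
variable {Ω : Type*} [MeasurableSpace Ω] {μ : Measure Ω}

/-- Hoeffding's lemma in the form of a bound on an exponential moment. -/
lemma lintegral_exp_mul_le [IsProbabilityMeasure μ] {X : Ω → ℝ} {M : ℝ} (hX : Measurable X)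
    (hb : ∀ ω, |X ω| ≤ M) (s : ℝ) :
    ∫⁻ ω, ENNReal.ofReal (Real.exp (s * X ω)) ∂μ
      ≤ ENNReal.ofReal (Real.exp (s * ∫ ω, X ω ∂μ + s ^ 2 * M ^ 2 / 2)) := by
  have hIcc : ∀ᵐ ω ∂μ, X ω ∈ Set.Icc (-M) M :=
    Filter.Eventually.of_forall fun ω => abs_le.mp (hb ω)
  have h := hasSubgaussianMGF_of_mem_Icc hX.aemeasurable hIcc
  have hmgf := h.mgf_le s
  have hi : Integrable (fun ω => Real.exp (s * X ω)) μ :=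
    integrable_exp_mul_of_mem_Icc hX.aemeasurable hIcc
  -- The interval has length `2M`, so Hoeffding's variance proxy is `M²`.
  have hM : (((‖M - -M‖₊ / 2) ^ 2 : NNReal) : ℝ) = M ^ 2 := by
    push_cast
    rw [Real.norm_eq_abs, div_pow, sq_abs]
    ring
  rw [hM] at hmgf
  rw [← ofReal_integral_eq_lintegral_ofReal hi (Filter.Eventually.of_forall fun ω => by positivity)]
  refine ENNReal.ofReal_le_ofReal ?_
  have e : ∫ ω, Real.exp (s * X ω) ∂μ
      = Real.exp (s * ∫ ω, X ω ∂μ) * mgf (fun ω => X ω - ∫ ω, X ω ∂μ) μ s := by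
    rw [mgf, ← integral_const_mul]
    refine integral_congr_ae (Filter.Eventually.of_forall fun ω => ?_)
    simp only
    rw [← Real.exp_add]
    congr 1
    ring
  rw [e, Real.exp_add]
  refine mul_le_mul_of_nonneg_left (hmgf.trans (le_of_eq ?_)) (Real.exp_pos _).le
  congr 1
  ring

/-- The joint law is a product, so Tonelli applies. This replaces conditioning: the past is frozen
in `U` while the fresh noise `V` is averaged out. -/
lemma IndepFun.lintegral_decouple [IsProbabilityMeasure μ] {E E' : Type*} [MeasurableSpace E]
    [MeasurableSpace E']
    {U : Ω → E} {V : Ω → E'} (hU : Measurable U) (hV : Measurable V) (h : IndepFun U V μ)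
    {f : E × E' → ENNReal} (hf : Measurable f) :
    ∫⁻ ω, f (U ω, V ω) ∂μ = ∫⁻ ω, ∫⁻ ω', f (U ω, V ω') ∂μ ∂μ := by
  have : IsProbabilityMeasure (μ.map V) := Measure.isProbabilityMeasure_map hV.aemeasurable
  have h1 := (indepFun_iff_map_prod_eq_prod_map_map hU.aemeasurable hV.aemeasurable).mp h
  rw [← lintegral_map hf (hU.prodMk hV), h1, lintegral_prod _ hf.aemeasurable,
    lintegral_map hf.lintegral_prod_right' hU]
  refine lintegral_congr fun ω => ?_
  exact lintegral_map (hf.comp measurable_prodMk_left) hV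

/-- Lets independence pass to quantities determined by the past or the present without exhibiting
them as explicit functions of it. -/
lemma IndepFun.of_measurable_comap {E E' G G' : Type*} [mE : MeasurableSpace E]
    [mE' : MeasurableSpace E'] [MeasurableSpace G] [MeasurableSpace G']
    {U : Ω → E} {V : Ω → E'} (h : IndepFun U V μ) {U' : Ω → G} {V' : Ω → G'}
    (hU : Measurable[mE.comap U] U') (hV : Measurable[mE'.comap V] V') : IndepFun U' V' μ := by
  rw [IndepFun_iff_Indep] at h ⊢
  exact indep_of_indep_of_le_left (indep_of_indep_of_le_right h hV.comap_le) hU.comap_le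

end Probability

/-! ### Bias of the symmetrised estimator -/

section Estimator
variable {d : ℕ} {Ω : Type*}

/-- The noise of the mini-batch symmetrized estimator with noise vectors `z 1, …, z (b + 2)`. -/
def batchNoise (b : ℕ) (z : ℕ → Ω → Vec d) (ω : Ω) : Vec d :=
  (z 1 ω - z 2 ω) + (1 / (b : ℝ)) • ∑ j ∈ Finset.Icc 1 b, z (j + 2) ω

/-- The second sample contributes `-∇F(y)` and the batch mean `+∇F(y)`; these cancel, so the
reference point enters only through the noise. -/
lemma msge_eq {Ξ : Type*} (f : Vec d → Ξ → ℝ) (F : Vec d → ℝ) {b : ℕ} (hb : 0 < b) (y : Vec d)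
    (ξ : ℕ → ℕ → Ω → Ξ) (x : ℕ → Ω → Vec d) (t : ℕ) (ω : Ω) :
    msge f b y (x t ω) (fun j => ξ t j ω)
      = gradient F (x t ω) + batchNoise b (gradNoise f F y ξ x t) ω := by
  have hb' : (b : ℝ) ≠ 0 := by exact_mod_cast hb.ne'
  have h2 : ∀ j ∈ Finset.Icc 1 b, gradNoise f F y ξ x t (j + 2) ω
      = stochGrad f y (ξ t (j + 2) ω) - gradient F y := by
    intro j _
    rw [gradNoise, if_neg (by omega)]
  have h3 : (1 / (b : ℝ)) • (b • gradient F y) = gradient F y := by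
    rw [← Nat.cast_smul_eq_nsmul ℝ, smul_smul, one_div_mul_cancel hb', one_smul]
  rw [batchNoise, Finset.sum_congr rfl h2, Finset.sum_sub_distrib, Finset.sum_const, Nat.card_Icc,
    Nat.add_sub_cancel, smul_sub, h3, gradNoise, gradNoise, if_pos rfl, if_neg (by norm_num), msge]
  abel

lemma measurable_batchNoise {m : MeasurableSpace Ω} {b : ℕ} {z : ℕ → Ω → Vec d}
    (hz : ∀ j ∈ Finset.Icc 1 (b + 2), Measurable[m] (z j)) : Measurable[m] (batchNoise b z) := by
  have hz' : ∀ j ∈ Finset.Icc 1 b, Measurable[m] (z (j + 2)) := fun j hj =>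
    hz _ (by rw [Finset.mem_Icc] at hj ⊢; omega)
  exact ((hz 1 (by simp)).sub (hz 2 (by simp))).add
    ((Finset.measurable_sum _ hz').const_smul (1 / (b : ℝ)))

variable [MeasurableSpace Ω] {μ : Measure Ω} [IsProbabilityMeasure μ] {P : Vec d → ℝ} {p σ : ℝ}

lemma IsNoiseDensity.integral_norm_batchMean_le (hP : IsNoiseDensity P p σ) {t : ℕ} (ht : 1 ≤ t)
    {z : ℕ → Ω → Vec d} (hz : ∀ j ∈ Finset.Icc 1 (batchSize p t + 2), Measurable (z j))
    (hlaw : ∀ j ∈ Finset.Icc 1 (batchSize p t + 2), μ.map (z j) = densityLaw P)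
    (hind : iIndepFun (fun j : Finset.Icc 1 (batchSize p t + 2) => z j) μ) :
    Integrable (fun ω => (1 / (batchSize p t : ℝ)) •
      ∑ j ∈ Finset.Icc 1 (batchSize p t), z (j + 2) ω) μ ∧
    ∫ ω, ‖(1 / (batchSize p t : ℝ)) • ∑ j ∈ Finset.Icc 1 (batchSize p t), z (j + 2) ω‖ ∂μ
      ≤ 3 * σ / √t := by
  set b := batchSize p t with hb
  have hb0 : (0 : ℝ) < b := by exact_mod_cast batchSize_pos p ht
  have hmem : ∀ j ∈ Finset.Icc 1 b, j + 2 ∈ Finset.Icc 1 (b + 2) := fun j hj => by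
    rw [Finset.mem_Icc] at hj ⊢
    omega
  have hm : ∀ j ∈ Finset.Icc 1 b, Measurable (z (j + 2)) := fun j hj => hz _ (hmem j hj)
  have hl : ∀ j ∈ Finset.Icc 1 b, μ.map (z (j + 2)) = densityLaw P := fun j hj =>
    hlaw _ (hmem j hj)
  have hint : ∀ j ∈ Finset.Icc 1 b, Integrable (z (j + 2)) μ := by
    intro j hj
    have := hP.integrable_id
    rw [← hl j hj] at this
    exact this.comp_measurable (hm j hj)
  refine ⟨(integrable_finsetSum _ hint).smul (1 / (b : ℝ)), ?_⟩
  have key := integral_norm_sum_le (μ := μ) (s := Finset.Icc 1 b) (Z := fun j => z (j + 2))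
    hP.one_lt hP.le_two hP.sigma_pos hm hint
    (fun j hj => by
      have := hP.unbiased
      rw [← hl j hj] at this
      exact (integral_map (hm j hj).aemeasurable
        measurable_id.aestronglyMeasurable).symm.trans this)
    (fun j hj => by
      have := hP.integrable_rpow
      rw [← hl j hj] at this
      exact this.comp_measurable (hm j hj))
    (fun j hj => by
      have := hP.integral_rpow_le
      rwa [← hl j hj, integral_map (hm j hj).aemeasurable
        (measurable_norm.pow_const p).aestronglyMeasurable] at this)
    (fun i hi j hj hij => hind.indepFun (i := ⟨i + 2, hmem i hi⟩) (j := ⟨j + 2, hmem j hj⟩)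
      (by simpa using hij))
  rw [Nat.card_Icc, Nat.add_sub_cancel] at key
  have h1 := batchSize_rpow_le hP.one_lt ht
  rw [← hb] at h1
  simp_rw [norm_smul, Real.norm_of_nonneg (by positivity : 0 ≤ 1 / (b : ℝ))]
  rw [integral_const_mul]
  have hσ := hP.sigma_pos
  calc 1 / (b : ℝ) * ∫ ω, ‖∑ j ∈ Finset.Icc 1 b, z (j + 2) ω‖ ∂μ
      ≤ 1 / (b : ℝ) * (3 * σ * (b : ℝ) ^ (1 / p)) := by gcongr
    _ = 3 * σ * ((b : ℝ) ^ (1 / p) / b) := by ring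
    _ ≤ 3 * σ * (1 / √t) := by gcongr
    _ = 3 * σ / √t := by ring

/-- The mean of the nonlinear estimator is within `O(t^{-1/2})` of the denoised nonlinearity. -/
lemma norm_integral_sub_denoised_le (hP : IsNoiseDensity P p σ) {Ψ : Vec d → Vec d} {K : NNReal}
    (hK : LipschitzWith K Ψ) {C : ℝ} (hC : ∀ x, ‖Ψ x‖ ≤ C) {t : ℕ} (ht : 1 ≤ t)
    {z : ℕ → Ω → Vec d} (hz : ∀ j ∈ Finset.Icc 1 (batchSize p t + 2), Measurable (z j))
    (hlaw : ∀ j ∈ Finset.Icc 1 (batchSize p t + 2), μ.map (z j) = densityLaw P)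
    (hind : iIndepFun (fun j : Finset.Icc 1 (batchSize p t + 2) => z j) μ) (g : Vec d) :
    ‖∫ ω, Ψ (g + batchNoise (batchSize p t) z ω) ∂μ - denoised Ψ P g‖ ≤ K * (3 * σ / √t) := by
  have := hP.isProbabilityMeasure
  have hcont : Continuous Ψ := hK.continuous
  set b := batchSize p t with hb
  have hm1 := hz 1 (by simp)
  have hm2 := hz 2 (by simp)
  have h12 : IndepFun (z 1) (z 2) μ :=
    hind.indepFun (i := ⟨1, by simp⟩) (j := ⟨2, by simp⟩) (by simp)
  -- Realising `Φ(g)` with the actual `z 1`, `z 2` makes the comparison pointwise: the two arguments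
  -- of `Ψ` differ exactly by the batch mean.
  have hden : denoised Ψ P g = ∫ ω, Ψ (g + (z 1 ω - z 2 ω)) ∂μ := by
    have hprod := (indepFun_iff_map_prod_eq_prod_map_map hm1.aemeasurable
      hm2.aemeasurable).mp h12
    rw [hlaw 1 (by simp), hlaw 2 (by simp)] at hprod
    rw [denoised, ← hprod, integral_map (hm1.prodMk hm2).aemeasurable
      (by fun_prop : Continuous _).aestronglyMeasurable]
  obtain ⟨hmint, hmle⟩ := hP.integral_norm_batchMean_le ht hz hlaw hind
  have hmeas : Measurable fun ω => Ψ (g + batchNoise b z ω) :=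
    hcont.measurable.comp ((measurable_batchNoise hz).const_add g)
  have hmeas' : Measurable fun ω => Ψ (g + (z 1 ω - z 2 ω)) :=
    hcont.measurable.comp ((hm1.sub hm2).const_add g)
  have hi : Integrable (fun ω => Ψ (g + batchNoise b z ω)) μ :=
    Integrable.of_bound hmeas.aestronglyMeasurable C (Filter.Eventually.of_forall fun _ => hC _)
  have hi' : Integrable (fun ω => Ψ (g + (z 1 ω - z 2 ω))) μ :=
    Integrable.of_bound hmeas'.aestronglyMeasurable C (Filter.Eventually.of_forall fun _ => hC _)
  rw [hden, ← integral_sub hi hi']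
  refine (norm_integral_le_integral_norm _).trans ?_
  calc ∫ ω, ‖Ψ (g + batchNoise b z ω) - Ψ (g + (z 1 ω - z 2 ω))‖ ∂μ
      ≤ ∫ ω, K * ‖(1 / (b : ℝ)) • ∑ j ∈ Finset.Icc 1 b, z (j + 2) ω‖ ∂μ := by
        refine integral_mono (hi.sub hi').norm (hmint.norm.const_mul _) fun ω => ?_
        have := hK.dist_le_mul (g + batchNoise b z ω) (g + (z 1 ω - z 2 ω))
        rw [dist_eq_norm, dist_eq_norm] at this
        refine this.trans (le_of_eq ?_)
        congr 2
        rw [batchNoise]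
        abel
    _ = K * ∫ ω, ‖(1 / (b : ℝ)) • ∑ j ∈ Finset.Icc 1 b, z (j + 2) ω‖ ∂μ := integral_const_mul _ _
    _ ≤ _ := by gcongr

end Estimator

/-! ### Absorbing errors into the progress -/

/-- The lower bound `min {γ₁ s, γ₂ s²}` on the progress made at a point with gradient norm `s`. -/
def progress (γ₁ γ₂ s : ℝ) : ℝ := min (γ₁ * s) (γ₂ * s ^ 2)

section Progress
variable {γ₁ γ₂ : ℝ}

lemma progress_mono (h₁ : 0 < γ₁) (h₂ : 0 < γ₂) {s t : ℝ} (hs : 0 ≤ s) (hst : s ≤ t) :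
    progress γ₁ γ₂ s ≤ progress γ₁ γ₂ t := by
  unfold progress
  gcongr

lemma continuous_progress : Continuous (progress γ₁ γ₂) := by
  unfold progress
  fun_prop

/-- Put `r = c/√T`. In the quadratic regime this is Young's inequality. In the linear regime, half
of the progress absorbs the bias when `r ≤ γ₁/2`; otherwise `1 < 2r/γ₁` and `αs ≤ M` give `Mr ≤
2Mr²/γ₁`. The remainder is `O(1/T)` in every case. -/
lemma bias_le_progress (h₁ : 0 < γ₁) (h₂ : 0 < γ₂) {a α c M s T : ℝ} (hα : 0 ≤ α) (hαa : α ≤ a)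
    (hc : 0 ≤ c) (hs : 0 ≤ s) (hM : α * s ≤ M) (hT : 0 < T) :
    α * (s * (c / √T)) ≤ 1 / 2 * (α * progress γ₁ γ₂ s)
      + (a * c ^ 2 / (2 * γ₂) + 2 * M * c ^ 2 / γ₁) / T := by
  have hM0 : 0 ≤ M := (mul_nonneg hα hs).trans hM
  have ha0 : 0 ≤ a := hα.trans hαa
  set r := c / √T with hr
  have hr0 : 0 ≤ r := by positivity
  have hr2 : r ^ 2 = c ^ 2 / T := by rw [hr, div_pow, Real.sq_sqrt hT.le]
  have e : (a * c ^ 2 / (2 * γ₂) + 2 * M * c ^ 2 / γ₁) / T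
      = a * r ^ 2 / (2 * γ₂) + 2 * M * r ^ 2 / γ₁ := by
    rw [hr2]
    field_simp
  rw [e]
  have p1 : 0 ≤ a * r ^ 2 / (2 * γ₂) := by positivity
  have p2 : 0 ≤ 2 * M * r ^ 2 / γ₁ := by positivity
  unfold progress
  rcases min_choice (γ₁ * s) (γ₂ * s ^ 2) with hmin | hmin
  · rw [hmin]
    rcases le_or_gt r (γ₁ / 2) with h | h
    · nlinarith [mul_le_mul_of_nonneg_left h (mul_nonneg hα hs)]
    · have h3 : M * r ≤ 2 * M * r ^ 2 / γ₁ := by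
        rw [le_div_iff₀ h₁]
        nlinarith [mul_nonneg hM0 hr0]
      have h4 : α * (s * r) ≤ M * r := by nlinarith
      have h5 : 0 ≤ α * (γ₁ * s) := by positivity
      linarith
  · rw [hmin]
    have h3 : s * r ≤ 1 / 2 * (γ₂ * s ^ 2) + r ^ 2 / (2 * γ₂) := by
      have : 1 / 2 * (γ₂ * s ^ 2) + r ^ 2 / (2 * γ₂) - s * r = (γ₂ * s - r) ^ 2 / (2 * γ₂) := by
        field_simp
        ring
      have : 0 ≤ (γ₂ * s - r) ^ 2 / (2 * γ₂) := by positivity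
      linarith
    have h4 : α * (r ^ 2 / (2 * γ₂)) ≤ a * r ^ 2 / (2 * γ₂) := by
      rw [mul_div_assoc]
      gcongr
    nlinarith [mul_le_mul_of_nonneg_left h3 hα]

/-- One factor of the Hoeffding term is capped, `αs` by `M` in the linear regime and `α` by `a` in
the quadratic one; `lam` is small enough that what remains is a quarter of the progress. -/
lemma fluctuation_le_progress {a α C M s lam : ℝ} (hα : 0 ≤ α)
    (hαa : α ≤ a) (hs : 0 ≤ s) (hM : α * s ≤ M) (hlam : 0 ≤ lam)
    (hl₁ : lam * (M * C ^ 2) ≤ γ₁ / 2) (hl₂ : lam * (a * C ^ 2) ≤ γ₂ / 2) :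
    lam * α ^ 2 * (C * s) ^ 2 / 2 ≤ 1 / 4 * (α * progress γ₁ γ₂ s) := by
  have hαs : 0 ≤ α * s := mul_nonneg hα hs
  have hlC : 0 ≤ lam * C ^ 2 := by positivity
  unfold progress
  rcases min_choice (γ₁ * s) (γ₂ * s ^ 2) with hmin | hmin
  · rw [hmin]
    have h3 : lam * C ^ 2 * (α * s) ≤ γ₁ / 2 :=
      (mul_le_mul_of_nonneg_left hM hlC).trans (by linarith)
    nlinarith [mul_le_mul_of_nonneg_left h3 hαs]
  · rw [hmin]
    have h3 : lam * C ^ 2 * α ≤ γ₂ / 2 :=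
      (mul_le_mul_of_nonneg_left hαa hlC).trans (by linarith)
    nlinarith [mul_le_mul_of_nonneg_left h3 (mul_nonneg hα (sq_nonneg s))]

/-- Converts a bound on the progress at the best iterate into one on its squared gradient norm. -/
lemma sq_le_of_progress_le (h₁ : 0 < γ₁) (h₂ : 0 < γ₂) {q G B : ℝ} (hq : 0 ≤ q) (hqG : q ≤ G)
    (hB : 0 ≤ B) (h : progress γ₁ γ₂ q ≤ B) :
    q ^ 2 ≤ (1 / γ₂ + G ^ 2 * γ₂ / γ₁ ^ 2) * B := by
  have p1 : 0 ≤ 1 / γ₂ * B := by positivity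
  have p2 : 0 ≤ G ^ 2 * γ₂ / γ₁ ^ 2 * B := by positivity
  unfold progress at h
  rcases le_or_gt (γ₂ * q) γ₁ with hle | hgt
  · rw [min_eq_right (by nlinarith)] at h
    have : q ^ 2 ≤ 1 / γ₂ * B := by
      rw [one_div, ← div_eq_inv_mul, le_div_iff₀ h₂]
      linarith
    linarith
  · rw [min_eq_left (by nlinarith)] at h
    -- In the linear regime `B` is bounded below, so the crude bound `q ≤ G` suffices and keeps the
    -- estimate linear in `B`.
    have h3 : γ₁ ^ 2 ≤ γ₂ * B := by nlinarith
    have h4 : q ^ 2 ≤ G ^ 2 := by gcongr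
    have h5 : G ^ 2 ≤ G ^ 2 * γ₂ / γ₁ ^ 2 * B := by
      rw [div_mul_eq_mul_div, le_div_iff₀ (by positivity)]
      nlinarith [mul_le_mul_of_nonneg_left h3 (sq_nonneg G)]
    linarith

end Progress

lemma one_div_sqrt_le (t : ℕ) : 1 / √((t : ℝ) + 1) ≤ 2 * (√((t : ℝ) + 1) - √t) := by
  have h0 : 0 < √((t : ℝ) + 1) := by positivity
  rw [div_le_iff₀ h0]
  have h1 : √((t : ℝ) + 1) ^ 2 = t + 1 := Real.sq_sqrt (by positivity)
  have h2 : √(t : ℝ) ^ 2 = t := Real.sq_sqrt (by positivity)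
  nlinarith [sq_nonneg (√((t : ℝ) + 1) - √t)]

/-! ### Growth of the gradient along the iterates -/

section Trajectory
variable {d : ℕ} {Ω : Type*} {Ψ : Vec d → Vec d} {F : Vec d → ℝ} {L C a G : ℝ}
  {x ζ : ℕ → Ω → Vec d}

/-- Each step moves the gradient by at most `L * C` times the step size, and the step sizes are
dominated by a telescoping sum of square roots. -/
lemma norm_gradient_le (hF : IsSmoothObjective F L) (hL : 0 < L) (hC : ∀ v, ‖Ψ v‖ ≤ C)
    (ha : 0 < a) (hG : ∀ ω, ‖gradient F (x 1 ω)‖ ≤ G)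
    (hstep : ∀ t ≥ 1, ∀ ω, x (t + 1) ω
      = x t ω - stepSize a (1 / 2) t • Ψ (gradient F (x t ω) + ζ t ω))
    {t : ℕ} (ht : 1 ≤ t) (ω : Ω) : ‖gradient F (x t ω)‖ ≤ G + 2 * a * L * C * √t := by
  have hC0 : 0 ≤ C := (norm_nonneg _).trans (hC 0)
  induction t, ht using Nat.le_induction with
  | base =>
    refine (hG ω).trans ?_
    have : 0 ≤ 2 * a * L * C * √((1 : ℕ) : ℝ) := by positivity
    linarith
  | succ t ht ih =>
    have h1 := hF.lipschitz (x (t + 1) ω) (x t ω)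
    have hα : 0 ≤ stepSize a (1 / 2) t := by rw [stepSize_half]; positivity
    rw [hstep t ht ω, sub_sub_cancel_left, norm_neg, norm_smul, Real.norm_of_nonneg hα,
      ← hstep t ht ω] at h1
    have h2 : L * (stepSize a (1 / 2) t * ‖Ψ (gradient F (x t ω) + ζ t ω)‖)
        ≤ L * (stepSize a (1 / 2) t * C) := by
      gcongr
      exact hC _
    have h3 : stepSize a (1 / 2) t ≤ a * (2 * (√((t : ℝ) + 1) - √t)) := by
      rw [stepSize_half, ← mul_one_div]
      exact mul_le_mul_of_nonneg_left (one_div_sqrt_le t) ha.le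
    have h4 := norm_le_norm_add_norm_sub' (gradient F (x (t + 1) ω)) (gradient F (x t ω))
    have h5 : L * (stepSize a (1 / 2) t * C) ≤ L * (a * (2 * (√((t : ℝ) + 1) - √t)) * C) := by
      gcongr
    push_cast
    linarith

/-- The step size offsets the `√t` growth exactly; the bound is uniform in `t`, so one `lam` serves
all iterations. -/
lemma stepSize_mul_norm_gradient_le (hF : IsSmoothObjective F L) (hL : 0 < L)
    (hC : ∀ v, ‖Ψ v‖ ≤ C) (ha : 0 < a) (hG0 : 0 ≤ G) (hG : ∀ ω, ‖gradient F (x 1 ω)‖ ≤ G)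
    (hstep : ∀ t ≥ 1, ∀ ω, x (t + 1) ω
      = x t ω - stepSize a (1 / 2) t • Ψ (gradient F (x t ω) + ζ t ω))
    {t : ℕ} (ht : 1 ≤ t) (ω : Ω) :
    stepSize a (1 / 2) t * ‖gradient F (x t ω)‖ ≤ a * (G + 2 * a * L * C) := by
  have hC0 : 0 ≤ C := (norm_nonneg _).trans (hC 0)
  have h := norm_gradient_le hF hL hC ha hG hstep ht ω
  have hs : √(t : ℝ) ≤ √((t : ℝ) + 1) := Real.sqrt_le_sqrt (by linarith)
  have hs1 : 1 ≤ √((t : ℝ) + 1) := Real.one_le_sqrt.mpr (by linarith [Nat.cast_nonneg (α := ℝ) t])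
  rw [stepSize_half, div_mul_eq_mul_div, div_le_iff₀ (by positivity), mul_assoc]
  refine mul_le_mul_of_nonneg_left (h.trans ?_) ha.le
  have : 0 ≤ 2 * a * L * C := by positivity
  nlinarith

lemma measurable_iterates [MeasurableSpace Ω] (hF : IsSmoothObjective F L) (hL : 0 < L)
    (hΨ : Continuous Ψ) {x₁ : Vec d} (hinit : ∀ ω, x 1 ω = x₁)
    (hstep : ∀ t ≥ 1, ∀ ω, x (t + 1) ω
      = x t ω - stepSize a (1 / 2) t • Ψ (gradient F (x t ω) + ζ t ω))
    (hζ : ∀ t ≥ 1, Measurable (ζ t)) {t : ℕ} (ht : 1 ≤ t) : Measurable (x t) := by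
  induction t, ht using Nat.le_induction with
  | base => rw [show x 1 = fun _ => x₁ from funext hinit]; exact measurable_const
  | succ t ht ih =>
    rw [show x (t + 1) = _ from funext (hstep t ht)]
    exact ih.sub ((hΨ.measurable.comp
      (((hF.continuous_gradient hL).measurable.comp ih).add (hζ t ht))).const_smul
        (stepSize a (1 / 2) t))

end Trajectory

/-! ### The exponential supermartingale -/

section Potential
variable {d : ℕ} {Ω : Type*}

/-- The exponent of the potential: function value plus accumulated progress minus the accumulated
deterministic error. -/
def potential (F : Vec d → ℝ) (x : ℕ → Ω → Vec d) (γ₁ γ₂ a c : ℝ) (t : ℕ) (ω : Ω) : ℝ :=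
  F (x t ω) + ∑ k ∈ Finset.Ico 1 t,
    (1 / 4 * (stepSize a (1 / 2) k * progress γ₁ γ₂ ‖gradient F (x k ω)‖) - c / k)

variable {Ψ : Vec d → Vec d} {F : Vec d → ℝ} {P : Vec d → ℝ}
  {p σ L C a G γ₁ γ₂ : ℝ} {x : ℕ → Ω → Vec d} {z : ℕ → ℕ → Ω → Vec d}

lemma measurable_potential {m : MeasurableSpace Ω} (hF : IsSmoothObjective F L) (hL : 0 < L)
    (c : ℝ) {t : ℕ} (ht : 1 ≤ t) (hx : ∀ k ∈ Finset.Icc 1 t, Measurable[m] (x k)) :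
    Measurable[m] (potential F x γ₁ γ₂ a c t) := by
  refine (hF.differentiable.continuous.measurable.comp
    (hx t (Finset.right_mem_Icc.mpr ht))).add ?_
  refine Finset.measurable_sum _ fun k hk => ?_
  have hxk := hx k (Finset.Ico_subset_Icc_self hk)
  exact (((continuous_progress.measurable.comp
    ((hF.continuous_gradient hL).measurable.comp hxk).norm).const_mul _).const_mul _).sub_const _

lemma measurable_comap_pi {ι E : Type*} [MeasurableSpace E] (X : ι → Ω → E) (i : ι) :
    Measurable[MeasurableSpace.comap (fun ω i => X i ω) MeasurableSpace.pi] (X i) :=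
  (measurable_pi_apply i).comp (comap_measurable fun ω i => X i ω)

variable [MeasurableSpace Ω] {μ : Measure Ω} [IsProbabilityMeasure μ]

/-- The conditional exponential moment of the decrease in one step. -/
lemma lintegral_exp_step_le (hP : IsNoiseDensity P p σ) {K : NNReal} (hK : LipschitzWith K Ψ)
    (hC : ∀ v, ‖Ψ v‖ ≤ C) (hγ : AreDenoisingConstants Ψ P γ₁ γ₂) {t : ℕ} (ht : 1 ≤ t)
    {z : ℕ → Ω → Vec d} (hz : ∀ j ∈ Finset.Icc 1 (batchSize p t + 2), Measurable (z j))
    (hlaw : ∀ j ∈ Finset.Icc 1 (batchSize p t + 2), μ.map (z j) = densityLaw P)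
    (hind : iIndepFun (fun j : Finset.Icc 1 (batchSize p t + 2) => z j) μ)
    {α M lam : ℝ} (hα : 0 ≤ α) (hαa : α ≤ a) {g : Vec d} (hM : α * ‖g‖ ≤ M) (hlam : 0 ≤ lam)
    (hl₁ : lam * (M * C ^ 2) ≤ γ₁ / 2) (hl₂ : lam * (a * C ^ 2) ≤ γ₂ / 2) :
    ∫⁻ ω, ENNReal.ofReal (Real.exp
        (-(lam * α) * inner ℝ g (Ψ (g + batchNoise (batchSize p t) z ω)))) ∂μ
      ≤ ENNReal.ofReal (Real.exp (lam * (-(1 / 4 * (α * progress γ₁ γ₂ ‖g‖))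
        + (a * (K * (3 * σ)) ^ 2 / (2 * γ₂) + 2 * M * (K * (3 * σ)) ^ 2 / γ₁) / t))) := by
  have hcont : Continuous Ψ := hK.continuous
  have hmeas : Measurable fun ω => Ψ (g + batchNoise (batchSize p t) z ω) :=
    hcont.measurable.comp ((measurable_batchNoise hz).const_add g)
  have hi : Integrable (fun ω => Ψ (g + batchNoise (batchSize p t) z ω)) μ :=
    Integrable.of_bound hmeas.aestronglyMeasurable C (Filter.Eventually.of_forall fun _ => hC _)
  have hb : ∀ ω, |inner ℝ g (Ψ (g + batchNoise (batchSize p t) z ω))| ≤ C * ‖g‖ := fun ω =>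
    (abs_real_inner_le_norm _ _).trans (by
      rw [mul_comm]
      exact mul_le_mul_of_nonneg_right (hC _) (norm_nonneg g))
  refine (lintegral_exp_mul_le (measurable_const.inner hmeas) hb _).trans
    (ENNReal.ofReal_le_ofReal (Real.exp_le_exp.mpr ?_))
  rw [integral_inner hi]
  set E := ∫ ω, Ψ (g + batchNoise (batchSize p t) z ω) ∂μ with hE
  have hbias := norm_integral_sub_denoised_le hP hK hC ht hz hlaw hind g
  rw [← hE] at hbias
  have hlow := hγ.lower_bound g
  have hinner : progress γ₁ γ₂ ‖g‖ - ‖g‖ * (K * (3 * σ) / √t) ≤ inner ℝ g E := by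
    have h1 : inner ℝ g E = inner ℝ (denoised Ψ P g) g + inner ℝ g (E - denoised Ψ P g) := by
      rw [inner_sub_right, real_inner_comm g (denoised Ψ P g)]
      ring
    have h2 := (abs_le.mp (abs_real_inner_le_norm g (E - denoised Ψ P g))).1
    have h3 := mul_le_mul_of_nonneg_left hbias (norm_nonneg g)
    rw [← mul_div_assoc] at h3
    rw [h1]
    unfold progress
    linarith
  have hσ := hP.sigma_pos
  have hT : (0 : ℝ) < t := by exact_mod_cast ht
  -- The bias costs half of the progress and the fluctuation a quarter, leaving the `1/4` of the
  -- potential.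
  have h4 := bias_le_progress hγ.pos₁ hγ.pos₂ hα hαa (by positivity : 0 ≤ K * (3 * σ))
    (norm_nonneg g) hM hT
  have h5 := fluctuation_le_progress (C := C) hα hαa (norm_nonneg g) hM hlam hl₁ hl₂
  have h6 := mul_le_mul_of_nonneg_left hinner (mul_nonneg hlam hα)
  have h7 := mul_le_mul_of_nonneg_left h4 hlam
  have h8 := mul_le_mul_of_nonneg_left h5 hlam
  nlinarith

/-- Exponential moments of the potential do not increase. -/
lemma lintegral_exp_potential_succ_le (hP : IsNoiseDensity P p σ) {K : NNReal}
    (hK : LipschitzWith K Ψ) (hC : ∀ v, ‖Ψ v‖ ≤ C) (hγ : AreDenoisingConstants Ψ P γ₁ γ₂)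
    (hF : IsSmoothObjective F L) (hL : 0 < L) (ha : 0 < a) {x₁ : Vec d}
    (hinit : ∀ ω, x 1 ω = x₁) (hG : ‖gradient F x₁‖ ≤ G)
    (hstep : ∀ t ≥ 1, ∀ ω, x (t + 1) ω = x t ω - stepSize a (1 / 2) t •
      Ψ (gradient F (x t ω) + batchNoise (batchSize p t) (z t) ω))
    (hz : IsIIDNoise μ P (batchSize p) z x) {M lam : ℝ} (hMdef : M = a * (G + 2 * a * L * C))
    (hlam : 0 ≤ lam) (hl₁ : lam * (M * C ^ 2) ≤ γ₁ / 2) (hl₂ : lam * (a * C ^ 2) ≤ γ₂ / 2)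
    {c : ℝ} (hc : c = a * (K * (3 * σ)) ^ 2 / (2 * γ₂) + 2 * M * (K * (3 * σ)) ^ 2 / γ₁
      + L * a ^ 2 * C ^ 2 / 2) {t : ℕ} (ht : 1 ≤ t) :
    ∫⁻ ω, ENNReal.ofReal (Real.exp (lam * potential F x γ₁ γ₂ a c (t + 1) ω)) ∂μ
      ≤ ∫⁻ ω, ENNReal.ofReal (Real.exp (lam * potential F x γ₁ γ₂ a c t ω)) ∂μ := by
  have hcont : Continuous Ψ := hK.continuous
  have hC0 : 0 ≤ C := (norm_nonneg _).trans (hC 0)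
  have hgc : Continuous (gradient F) := hF.continuous_gradient hL
  have hT : (0 : ℝ) < t := by exact_mod_cast ht
  have hζ : ∀ t ≥ 1, Measurable (batchNoise (batchSize p t) (z t)) := fun t ht =>
    measurable_batchNoise (hz.measurable t ht)
  have hx : ∀ k ≥ 1, Measurable (x k) := fun k hk =>
    measurable_iterates hF hL hcont hinit hstep hζ hk
  set α := stepSize a (1 / 2) t with hαdef
  have hα : 0 ≤ α := by rw [hαdef, stepSize_half]; positivity
  have hsqrt : 1 ≤ √((t : ℝ) + 1) := Real.one_le_sqrt.mpr (by linarith)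
  have hαa : α ≤ a := by
    rw [hαdef, stepSize_half]
    exact div_le_self ha.le hsqrt
  have hα2 : α ^ 2 ≤ a ^ 2 / t := by
    rw [hαdef, stepSize_half, div_pow, Real.sq_sqrt (by positivity)]
    gcongr
    linarith
  set e₁ := (a * (K * (3 * σ)) ^ 2 / (2 * γ₂) + 2 * M * (K * (3 * σ)) ^ 2 / γ₁) / t with he₁
  have hce : c / t = e₁ + L * a ^ 2 * C ^ 2 / 2 / t := by rw [hc, he₁, add_div]
  set g : Ω → Vec d := fun ω => gradient F (x t ω) with hg
  set ζ : Ω → Vec d := batchNoise (batchSize p t) (z t) with hζdef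
  -- `W` is the part of the next exponential known before iteration `t`; `f` multiplies it by the
  -- only factor involving fresh noise.
  set W : Ω → ENNReal := fun ω => ENNReal.ofReal (Real.exp (lam * (potential F x γ₁ γ₂ a c t ω
    + 1 / 4 * (α * progress γ₁ γ₂ ‖g ω‖) - e₁))) with hW
  set f : (ENNReal × Vec d) × Vec d → ENNReal := fun w => w.1.1 * ENNReal.ofReal (Real.exp
    (-(lam * α) * inner ℝ (gradient F w.1.2) (Ψ (gradient F w.1.2 + w.2)))) with hf
  have hfm : Measurable f := by
    have h1 : Continuous fun w : (ENNReal × Vec d) × Vec d => gradient F w.1.2 :=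
      hgc.comp (continuous_snd.comp continuous_fst)
    have h2 : Continuous fun w : (ENNReal × Vec d) × Vec d => Real.exp
        (-(lam * α) * inner ℝ (gradient F w.1.2) (Ψ (gradient F w.1.2 + w.2))) := by fun_prop
    exact (measurable_fst.comp measurable_fst).mul h2.measurable.ennreal_ofReal
  have hpt : ∀ ω, ENNReal.ofReal (Real.exp (lam * potential F x γ₁ γ₂ a c (t + 1) ω))
      ≤ f ((W ω, x t ω), ζ ω) := by
    intro ω
    rw [hf, hW]
    simp only
    rw [← ENNReal.ofReal_mul (Real.exp_pos _).le, ← Real.exp_add]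
    refine ENNReal.ofReal_le_ofReal (Real.exp_le_exp.mpr ?_)
    have hdesc := hF.le_quadratic (x t ω) (-(α • Ψ (g ω + ζ ω)))
    rw [← sub_eq_add_neg, ← hstep t ht ω, inner_neg_right, real_inner_smul_right, norm_neg,
      norm_smul, Real.norm_of_nonneg hα, mul_pow] at hdesc
    have hsq : L / 2 * (α ^ 2 * ‖Ψ (g ω + ζ ω)‖ ^ 2) ≤ L / 2 * (a ^ 2 / t * C ^ 2) := by
      gcongr
      exact hC _
    have hsq' : L / 2 * (a ^ 2 / t * C ^ 2) = L * a ^ 2 * C ^ 2 / 2 / t := by ring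
    have hpot : potential F x γ₁ γ₂ a c (t + 1) ω = F (x (t + 1) ω) - F (x t ω)
        + potential F x γ₁ γ₂ a c t ω + (1 / 4 * (α * progress γ₁ γ₂ ‖g ω‖) - c / t) := by
      rw [potential, potential, Finset.sum_Ico_succ_top ht]
      ring
    have hfin : potential F x γ₁ γ₂ a c (t + 1) ω ≤ potential F x γ₁ γ₂ a c t ω
        + 1 / 4 * (α * progress γ₁ γ₂ ‖g ω‖) - e₁ - α * inner ℝ (g ω) (Ψ (g ω + ζ ω)) := by
      rw [hpot]
      linarith
    have := mul_le_mul_of_nonneg_left hfin hlam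
    refine this.trans (le_of_eq ?_)
    ring
  have hpast : ∀ k ∈ Finset.Icc 1 t, Measurable[MeasurableSpace.comap
      (fun ω (k : Finset.Icc 1 t) => x k ω) MeasurableSpace.pi] (x k) := fun k hk =>
    measurable_comap_pi (fun k : Finset.Icc 1 t => x k) ⟨k, hk⟩
  -- The accumulated progress involves all earlier gradients, so independence from the whole history
  -- `x 1, …, x t` is needed, not just from `x t`.
  have hWpast : Measurable[MeasurableSpace.comap
      (fun ω (k : Finset.Icc 1 t) => x k ω) MeasurableSpace.pi] fun ω => (W ω, x t ω) := by
    have aux : ∀ m : MeasurableSpace Ω, Measurable[m] (potential F x γ₁ γ₂ a c t) →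
        Measurable[m] (x t) → Measurable[m] fun ω => (W ω, x t ω) := by
      intro m hpot hxt
      have hprog : Measurable fun ω => 1 / 4 * (α * progress γ₁ γ₂ ‖g ω‖) :=
        ((continuous_progress.measurable.comp
          (hgc.measurable.comp hxt).norm).const_mul _).const_mul _
      exact (Real.measurable_exp.comp
        (((hpot.add hprog).sub_const e₁).const_mul lam)).ennreal_ofReal.prodMk hxt
    exact aux _ (measurable_potential hF hL c ht hpast) (hpast t (Finset.right_mem_Icc.mpr ht))
  have hζpresent : Measurable[MeasurableSpace.comap
      (fun ω (j : Finset.Icc 1 (batchSize p t + 2)) => z t j ω) MeasurableSpace.pi] ζ :=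
    measurable_batchNoise fun j hj =>
      measurable_comap_pi (fun j : Finset.Icc 1 (batchSize p t + 2) => z t j) ⟨j, hj⟩
  have hind : IndepFun (fun ω => (W ω, x t ω)) ζ μ :=
    IndepFun.of_measurable_comap (hz.indep_past t ht).symm hWpast hζpresent
  have hWm : Measurable fun ω => (W ω, x t ω) := by
    refine hWpast.mono ?_ le_rfl
    exact (measurable_pi_lambda _ fun k : Finset.Icc 1 t =>
      hx k (Finset.mem_Icc.mp k.2).1).comap_le
  calc ∫⁻ ω, ENNReal.ofReal (Real.exp (lam * potential F x γ₁ γ₂ a c (t + 1) ω)) ∂μ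
      ≤ ∫⁻ ω, f ((W ω, x t ω), ζ ω) ∂μ := lintegral_mono hpt
    _ = ∫⁻ ω, ∫⁻ ω', f ((W ω, x t ω), ζ ω') ∂μ ∂μ :=
        IndepFun.lintegral_decouple hWm (hζ t ht) hind hfm
    _ ≤ ∫⁻ ω, ENNReal.ofReal (Real.exp (lam * potential F x γ₁ γ₂ a c t ω)) ∂μ := by
        refine lintegral_mono fun ω => ?_
        rw [hf]
        simp only
        rw [lintegral_const_mul' _ _ ENNReal.ofReal_ne_top]
        have hM : α * ‖g ω‖ ≤ M := by
          rw [hMdef]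
          exact stepSize_mul_norm_gradient_le hF hL hC ha ((norm_nonneg _).trans hG)
            (fun ω => by rw [hinit]; exact hG) hstep ht ω
        refine (mul_le_mul_right (lintegral_exp_step_le (μ := μ) (g := g ω) hP hK hC hγ ht
          (hz.measurable t ht) (hz.law t ht) (hz.indep t ht) hα hαa hM hlam hl₁ hl₂) _).trans
          (le_of_eq ?_)
        rw [← ENNReal.ofReal_mul (Real.exp_pos _).le, ← Real.exp_add]
        congr 2
        rw [he₁]
        ring

end Potential

/-! ### From the potential to the rate -/

section Convergence
variable {d : ℕ} {Ω : Type*} {Ψ : Vec d → Vec d} {F : Vec d → ℝ} {P : Vec d → ℝ}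
  {p σ L C a G γ₁ γ₂ : ℝ} {x : ℕ → Ω → Vec d} {z : ℕ → ℕ → Ω → Vec d}

/-- A potential below the threshold forces some iterate to have a small gradient. -/
lemma exists_norm_gradient_sq_le (hF : IsSmoothObjective F L) (h₁ : 0 < γ₁) (h₂ : 0 < γ₂)
    (ha : 0 < a)
    {c lam Δ δ : ℝ} (hc : 0 ≤ c) (hlam : 0 < lam) {ω : Ω} (hG : ‖gradient F (x 1 ω)‖ ≤ G)
    (hΔ : F (x 1 ω) - ⨅ v, F v ≤ Δ) {t : ℕ} (ht : 2 ≤ t) (hδ : 0 < δ) (hδ1 : δ < 1)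
    (hpot : potential F x γ₁ γ₂ a c (t + 1) ω < F (x 1 ω) + Real.log (1 / δ) / lam) :
    ∃ k ∈ Finset.Icc 1 t, ‖gradient F (x k ω)‖ ^ 2
      ≤ (1 / γ₂ + G ^ 2 * γ₂ / γ₁ ^ 2) * (8 * (2 * Δ + 3 * c + 1 / lam) / a)
        * (Real.log (t / δ) / √t) := by
  have hne : (Finset.Icc 1 t).Nonempty := Finset.nonempty_Icc.mpr (by omega)
  obtain ⟨k₀, hk₀, hmin⟩ := Finset.exists_min_image (Finset.Icc 1 t)
    (fun k => ‖gradient F (x k ω)‖) hne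
  set q := ‖gradient F (x k₀ ω)‖ with hq
  have hq0 : 0 ≤ q := norm_nonneg _
  refine ⟨k₀, hk₀, ?_⟩
  have hqG : q ≤ G := (hmin 1 (Finset.mem_Icc.mpr ⟨le_rfl, by omega⟩)).trans hG
  have ht2 : (2 : ℝ) ≤ t := by exact_mod_cast ht
  have hT : (0 : ℝ) < t := by linarith
  have hsq : √(t : ℝ) ^ 2 = t := Real.sq_sqrt hT.le
  have hsqrt : 0 < √(t : ℝ) := Real.sqrt_pos.mpr hT
  have hinf : ⨅ v, F v ≤ F (x (t + 1) ω) := ciInf_le hF.bddBelow _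
  have hinf1 : ⨅ v, F v ≤ F (x 1 ω) := ciInf_le hF.bddBelow _
  have hΔ0 : 0 ≤ Δ := by linarith
  set ℓ := Real.log (t / δ) with hℓ
  have hℓ_eq : ℓ = Real.log t + Real.log (1 / δ) := by
    rw [hℓ, ← Real.log_mul hT.ne' (by positivity), mul_one_div]
  -- From `t ≥ 2`: constants can then be absorbed into multiples of `ℓ`, as `1 ≤ 2ℓ`.
  have hlogt : 1 / 2 ≤ Real.log t := by
    have := Real.log_two_gt_d9
    have h2 := Real.log_le_log (by norm_num : (0 : ℝ) < 2) ht2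
    linarith
  have hlogδ : 0 ≤ Real.log (1 / δ) := Real.log_nonneg ((one_le_div hδ).mpr hδ1.le)
  have hharm : ∑ k ∈ Finset.Ico 1 (t + 1), c / (k : ℝ) ≤ c * (1 + Real.log t) := by
    have h := harmonic_le_one_add_log t
    rw [harmonic_eq_sum_Icc] at h
    push_cast at h
    rw [Finset.Ico_add_one_right_eq_Icc]
    simp_rw [div_eq_mul_inv, ← Finset.mul_sum]
    exact mul_le_mul_of_nonneg_left h hc
  have hm0 : 0 ≤ progress γ₁ γ₂ q := by
    unfold progress
    positivity
  have hprog : t * (1 / 4 * (a / √((t : ℝ) + 1) * progress γ₁ γ₂ q))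
      ≤ ∑ k ∈ Finset.Ico 1 (t + 1),
        1 / 4 * (stepSize a (1 / 2) k * progress γ₁ γ₂ ‖gradient F (x k ω)‖) := by
    have hcard : (t : ℝ) * (1 / 4 * (a / √((t : ℝ) + 1) * progress γ₁ γ₂ q))
        = ∑ _k ∈ Finset.Ico 1 (t + 1), 1 / 4 * (a / √((t : ℝ) + 1) * progress γ₁ γ₂ q) := by
      rw [Finset.sum_const, nsmul_eq_mul, Nat.card_Ico, Nat.add_sub_cancel]
    rw [hcard]
    refine Finset.sum_le_sum fun k hk => ?_
    rw [Finset.Ico_add_one_right_eq_Icc] at hk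
    have hkt : (k : ℝ) ≤ t := by exact_mod_cast (Finset.mem_Icc.mp hk).2
    have hstepk : a / √((t : ℝ) + 1) ≤ stepSize a (1 / 2) k := by
      rw [stepSize_half]
      gcongr
    have hpk : progress γ₁ γ₂ q ≤ progress γ₁ γ₂ ‖gradient F (x k ω)‖ :=
      progress_mono h₁ h₂ hq0 (hmin k hk)
    have : 0 ≤ stepSize a (1 / 2) k := by rw [stepSize_half]; positivity
    gcongr
  rw [potential, Finset.sum_sub_distrib] at hpot
  have hscale : a * √t / 8 * progress γ₁ γ₂ q
      ≤ t * (1 / 4 * (a / √((t : ℝ) + 1) * progress γ₁ γ₂ q)) := by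
    have h1 : √((t : ℝ) + 1) ≤ 2 * √t := by
      rw [Real.sqrt_le_left (by positivity), mul_pow, hsq]
      linarith
    have h2 : √(t : ℝ) / 2 ≤ t / √((t : ℝ) + 1) := by
      rw [le_div_iff₀ (by positivity)]
      nlinarith
    calc a * √t / 8 * progress γ₁ γ₂ q = 1 / 4 * (a * progress γ₁ γ₂ q) * (√t / 2) := by ring
      _ ≤ 1 / 4 * (a * progress γ₁ γ₂ q) * (t / √((t : ℝ) + 1)) := by gcongr
      _ = _ := by ring
  have hlog_lam : Real.log (1 / δ) / lam ≤ 1 / lam * ℓ := by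
    rw [one_div_mul_eq_div]
    gcongr
    linarith
  have hmain : a * √t / 8 * progress γ₁ γ₂ q ≤ (2 * Δ + 3 * c + 1 / lam) * ℓ := by
    have h1 : Δ ≤ 2 * Δ * ℓ := by nlinarith
    have h2 : c * (1 + Real.log t) ≤ 3 * c * ℓ := by nlinarith
    linarith
  have hprogress : progress γ₁ γ₂ q ≤ 8 * (2 * Δ + 3 * c + 1 / lam) / a * (ℓ / √t) := by
    rw [div_mul_div_comm, le_div_iff₀ (by positivity)]
    linarith
  have hℓ0 : 0 ≤ ℓ := by linarith
  rw [mul_assoc]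
  exact sq_le_of_progress_le h₁ h₂ hq0 hqG (by positivity) hprogress

variable [MeasurableSpace Ω] {μ : Measure Ω} [IsProbabilityMeasure μ]

/-- With high probability the potential exceeds its initial value by at most `log(1/δ) / lam`. -/
lemma measure_potential_ge_le (hP : IsNoiseDensity P p σ) {K : NNReal}
    (hK : LipschitzWith K Ψ) (hC : ∀ v, ‖Ψ v‖ ≤ C) (hγ : AreDenoisingConstants Ψ P γ₁ γ₂)
    (hF : IsSmoothObjective F L) (hL : 0 < L) (ha : 0 < a) {x₁ : Vec d}
    (hinit : ∀ ω, x 1 ω = x₁) (hG : ‖gradient F x₁‖ ≤ G)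
    (hstep : ∀ t ≥ 1, ∀ ω, x (t + 1) ω = x t ω - stepSize a (1 / 2) t •
      Ψ (gradient F (x t ω) + batchNoise (batchSize p t) (z t) ω))
    (hz : IsIIDNoise μ P (batchSize p) z x) {M lam : ℝ} (hMdef : M = a * (G + 2 * a * L * C))
    (hlam : 0 < lam) (hl₁ : lam * (M * C ^ 2) ≤ γ₁ / 2) (hl₂ : lam * (a * C ^ 2) ≤ γ₂ / 2)
    {c : ℝ} (hc : c = a * (K * (3 * σ)) ^ 2 / (2 * γ₂) + 2 * M * (K * (3 * σ)) ^ 2 / γ₁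
      + L * a ^ 2 * C ^ 2 / 2) {t : ℕ} (ht : 1 ≤ t) {δ : ℝ} (hδ : 0 < δ) :
    μ {ω | F x₁ + Real.log (1 / δ) / lam ≤ potential F x γ₁ γ₂ a c t ω} ≤ ENNReal.ofReal δ := by
  have hmom : ∀ t ≥ 1, ∫⁻ ω, ENNReal.ofReal (Real.exp (lam * potential F x γ₁ γ₂ a c t ω)) ∂μ
      ≤ ENNReal.ofReal (Real.exp (lam * F x₁)) := by
    intro t ht
    induction t, ht using Nat.le_induction with
    -- At time `1` the sum is empty and the starting point deterministic.
    | base => simp [potential, hinit]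
    | succ t ht ih =>
      exact (lintegral_exp_potential_succ_le hP hK hC hγ hF hL ha hinit hG hstep hz hMdef hlam.le
        hl₁ hl₂ hc ht).trans ih
  have hx : ∀ k ≥ 1, Measurable (x k) := fun k hk =>
    measurable_iterates hF hL hK.continuous hinit hstep
      (fun t ht => measurable_batchNoise (hz.measurable t ht)) hk
  have hmeas : Measurable fun ω =>
      ENNReal.ofReal (Real.exp (lam * potential F x γ₁ γ₂ a c t ω)) :=
    (Real.measurable_exp.comp ((measurable_potential hF hL c ht fun k hk =>
      hx k (Finset.mem_Icc.mp hk).1).const_mul _)).ennreal_ofReal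
  set B := Real.exp (lam * F x₁) with hB
  have hB0 : 0 < B := Real.exp_pos _
  have hBδ : ENNReal.ofReal (B / δ) ≠ 0 := by simpa using div_pos hB0 hδ
  have hsub : {ω | F x₁ + Real.log (1 / δ) / lam ≤ potential F x γ₁ γ₂ a c t ω}
      ⊆ {ω | ENNReal.ofReal (B / δ)
        ≤ ENNReal.ofReal (Real.exp (lam * potential F x γ₁ γ₂ a c t ω))} := by
    intro ω hω
    refine ENNReal.ofReal_le_ofReal ?_
    have h1 : lam * (F x₁ + Real.log (1 / δ) / lam) ≤ lam * potential F x γ₁ γ₂ a c t ω :=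
      mul_le_mul_of_nonneg_left hω hlam.le
    calc B / δ = Real.exp (lam * (F x₁ + Real.log (1 / δ) / lam)) := by
          rw [mul_add, mul_div_cancel₀ _ hlam.ne', Real.exp_add, Real.exp_log (by positivity)]
          ring
      _ ≤ _ := Real.exp_le_exp.mpr h1
  calc μ {ω | F x₁ + Real.log (1 / δ) / lam ≤ potential F x γ₁ γ₂ a c t ω}
      ≤ _ := measure_mono hsub
    _ ≤ (∫⁻ ω, ENNReal.ofReal (Real.exp (lam * potential F x γ₁ γ₂ a c t ω)) ∂μ)
        / ENNReal.ofReal (B / δ) := meas_ge_le_lintegral_div hmeas.aemeasurable hBδ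
          ENNReal.ofReal_ne_top
    _ ≤ ENNReal.ofReal B / ENNReal.ofReal (B / δ) := by
        gcongr
        exact hmom t ht
    _ = ENNReal.ofReal δ := by
        rw [← ENNReal.ofReal_div_of_pos (by positivity)]
        congr 1
        field_simp

end Convergence

end

theorem corollary3 {d : ℕ} (Ψ : Vec d → Vec d) (P : Vec d → ℝ) (p σ C : ℝ)
    (hΨ : IsSmoothNonlinearity Ψ) (hP : IsNoiseDensity P p σ)
    (hC : 0 < C) (hΨC : ∀ x, ‖Ψ x‖ ≤ C) :
    (∃ γ₁ γ₂ : ℝ, AreDenoisingConstants Ψ P γ₁ γ₂) ∧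
    ∀ γ₁ γ₂ : ℝ, AreDenoisingConstants Ψ P γ₁ γ₂ →
    ∀ L Δ G a : ℝ, 0 < L → StepSizeCondition a (1 / 2) γ₁ γ₂ C L G →
    ∃ A : ℝ, 0 < A ∧
      ∀ {Ω Ξ : Type*} [MeasurableSpace Ω] [MeasurableSpace Ξ]
        (μ : Measure Ω) [IsProbabilityMeasure μ] (D : Measure Ξ) [IsProbabilityMeasure D]
        (f : Vec d → Ξ → ℝ) (F : Vec d → ℝ) (x₁ y : Vec d)
        (ξ : ℕ → ℕ → Ω → Ξ) (x : ℕ → Ω → Vec d),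
        (∀ s, Differentiable ℝ fun v => f v s) →
        (∀ v, Integrable (f v) D) →
        F = populationCost f D →
        IsSmoothObjective F L →
        F x₁ - ⨅ v, F v = Δ →
        ‖gradient F x₁‖ = G →
        (∀ t ≥ 1, ∀ j ∈ Finset.Icc 1 (batchSize p t + 2),
          Measurable (ξ t j) ∧ μ.map (ξ t j) = D) →
        IsNMSGE f Ψ (stepSize a (1 / 2)) (batchSize p) x₁ y ξ x →
        IsIIDNoise μ P (batchSize p) (gradNoise f F y ξ x) x →
        ∀ (t : ℕ) (ht : 2 ≤ t) (δ : ℝ), 0 < δ → δ < 1 →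
          1 - δ ≤ μ.real {ω |
            (Finset.Icc 1 t).inf' (Finset.nonempty_Icc.mpr (by omega))
                (fun k => ‖gradient F (x k ω)‖ ^ 2)
              ≤ A * (Real.log (t / δ) / √t)} := by
  have hreg := hΨ.isRegularOperator
  refine ⟨exists_areDenoisingConstants hreg hP hΨC, ?_⟩
  intro γ₁ γ₂ hγ L Δ G a hL hstepcond
  obtain ⟨ha, -⟩ := hstepcond
  obtain ⟨K, hK⟩ := hreg.lipschitz
  have h₁ := hγ.pos₁
  have h₂ := hγ.pos₂
  have hσ := hP.sigma_pos
  -- The constants are fixed before `G` and `Δ` are tied to an objective; absolute values keep them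
  -- of the right sign.
  set M : ℝ := a * (|G| + 2 * a * L * C) with hM
  have hM0 : 0 < M := by positivity
  set lam : ℝ := min (γ₁ / 2 / (M * C ^ 2)) (γ₂ / 2 / (a * C ^ 2)) with hlam
  have hlam0 : 0 < lam := by positivity
  have hl₁ : lam * (M * C ^ 2) ≤ γ₁ / 2 :=
    (le_div_iff₀ (by positivity)).mp (min_le_left _ _)
  have hl₂ : lam * (a * C ^ 2) ≤ γ₂ / 2 :=
    (le_div_iff₀ (by positivity)).mp (min_le_right _ _)
  set c : ℝ := a * (K * (3 * σ)) ^ 2 / (2 * γ₂) + 2 * M * (K * (3 * σ)) ^ 2 / γ₁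
    + L * a ^ 2 * C ^ 2 / 2 with hc
  have hc0 : 0 ≤ c := by positivity
  refine ⟨(1 / γ₂ + |G| ^ 2 * γ₂ / γ₁ ^ 2) * (8 * (2 * |Δ| + 3 * c + 1 / lam) / a),
    by positivity, ?_⟩
  intro Ω Ξ _ _ μ _ D _ f F x₁ y ξ x _ _ _ hF hΔ hG _ hx hz t ht δ hδ hδ1
  have hstep : ∀ t ≥ 1, ∀ ω, x (t + 1) ω = x t ω - stepSize a (1 / 2) t •
      Ψ (gradient F (x t ω) + batchNoise (batchSize p t) (gradNoise f F y ξ x t) ω) := by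
    intro t ht ω
    rw [hx.step t ht ω, msge_eq f F (batchSize_pos p ht)]
  -- The potential at time `t + 1` sums the progress over precisely the iterates `1, …, t`.
  have hbad := measure_potential_ge_le hP hK hΨC hγ hF hL ha hx.init (hG.le.trans (le_abs_self G))
    hstep hz hM hlam0 hl₁ hl₂ hc (t := t + 1) (by omega) hδ
  set bad : Set Ω :=
    {ω | F x₁ + Real.log (1 / δ) / lam ≤ potential F x γ₁ γ₂ a c (t + 1) ω} with hbaddef
  set good : Set Ω := {ω | (Finset.Icc 1 t).inf' (Finset.nonempty_Icc.mpr (by omega))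
    (fun k => ‖gradient F (x k ω)‖ ^ 2)
      ≤ (1 / γ₂ + |G| ^ 2 * γ₂ / γ₁ ^ 2) * (8 * (2 * |Δ| + 3 * c + 1 / lam) / a)
        * (Real.log (t / δ) / √t)} with hgood
  -- A cover and subadditivity avoid any measurability of `good`.
  have hcover : Set.univ ⊆ good ∪ bad := by
    intro ω _
    by_cases hω : ω ∈ bad
    · exact Or.inr hω
    · obtain ⟨k, hk, hle⟩ := exists_norm_gradient_sq_le (x := x) (ω := ω) (G := |G|)
        (Δ := |Δ|) hF h₁ h₂ ha hc0 hlam0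
        (by rw [hx.init]; exact hG.le.trans (le_abs_self G))
        (by rw [hx.init]; exact hΔ.le.trans (le_abs_self Δ)) ht hδ hδ1
        (by rw [hx.init]; exact not_le.mp hω)
      exact Or.inl ((Finset.inf'_le (fun k => ‖gradient F (x k ω)‖ ^ 2) hk).trans hle)
  have hbadreal : μ.real bad ≤ δ := ENNReal.toReal_le_of_le_ofReal hδ.le hbad
  have hone : 1 ≤ μ.real good + μ.real bad := by
    calc (1 : ℝ) = μ.real Set.univ := probReal_univ.symm
      _ ≤ μ.real (good ∪ bad) := measureReal_mono hcover
      _ ≤ _ := measureReal_union_le _ _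
  linarith
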